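/- Let $\mathcal M$ and $\mathcal N$ be non-empty, connected, complete, finite-dimensional smooth Riemannian manifolds (without boundary) with distances $d_{\mathcal M}, d_{\mathcal N}$, and let $f,g:\mathcal M\times\mathcal N\to\mathbb R$ be continuously differentiable. Let $l_{f,0}\in\mathbb R$, $l_{f,1},l_{g,1}\ge 0$ and $\mu_g>0$ be constants such that: (i) the Riemannian gradients of $f$ and $g$ on the Riemannian product $\mathcal M\times\mathcal N$ are $l_{f,1}$- and $l_{g,1}$-Lipschitz respectively, that is, for $h=f$, $l=l_{f,1}$ and for $h=g$, $l=l_{g,1}$, and for every minimizing geodesic of $\mathcal M\times\mathcal N$ from a point $p$ to a point $q$, $\|\mathrm{PT}_{q\leftarrow p}\nabla h(p)-\nabla h(q)\|\le l\, d(p,q)$, where $\mathrm{PT}_{q\leftarrow p}$ is Levi-Civita parallel transport along that geodesic; (ii) $\|\nabla_y f(x,y)\|\le l_{f,0}$ for all $x\in\mathcal M$, $y\in\mathcal N$; (iii) for every $x\in\mathcal M$ the function $g(x,\cdot)$ is geodesically $\mu_g$-strongly convex on $\mathcal N$, that is, $g(x,\gamma(t))\le(1-t)g(x,\gamma(0))+t\,g(x,\gamma(1))-\frac{\mu_g}{2}t(1-t)\,d_{\mathcal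 N}(\gamma(0),\gamma(1))^2$ for every minimizing geodesic $\gamma:[0,1]\to\mathcal N$ and every $t\in[0,1]$. For $\lambda>0$ put $\mathcal L_\lambda(x,y)=f(x,y)+\lambda\,(g(x,y)-g^*(x))$ with $g^*(x)=\min_{y}g(x,y)$. Then for every $x\in\mathcal M$ the function $g(x,\cdot)$ has a unique minimizer $y^*(x)$, and for every $\lambda>0$ with $\lambda\ge 2l_{f,1}/\mu_g$ the function $\mathcal L_\lambda(x,\cdot)$ has a unique minimizer $y^*_\lambda(x)$. There is a constant $l_{\lambda,0}\le 3l_{g,1}/\mu_g$ such that for all $\lambda_2\ge\lambda_1\ge 2l_{f,1}/\mu_g$ with $\lambda_1>0$ and all $x_1,x_2\in\mathcal M$, $$d_{\mathcal N}\big(y^*_{\lambda_1}(x_1),y^*_{\lambda_2}(x_2)\big)\le\frac{2(\lambda_2-\lambda_1)}{\lambda_1\lambda_2}\,\frac{l_{f,0}}{\mu_g}+l_{\lambda,0}\,d_{\mathcal M}(x_2,x_1).$$ Moreover, for every $\lambda>0$ with $\lambda\ge 2l_{f,1}/\mu_g$ and every $x\in\mathcal M$, $$d_{\mathcal N}\big(y^*_\lambda(x),y^*(x)\big)\le\frac{2l_{f,0}}{\lambda\mu_g}.$$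 -/

import Mathlib

open Set Bundle
open scoped Manifold ContDiff Bundle

noncomputable section

namespace RiemBilevel

/-! Throughout, `M` is a `d`-dimensional manifold without boundary, modelled on
`EuclideanSpace ℝ (Fin d)`, whose tangent spaces carry the inner products given by a
`RiemannianBundle` instance. -/

/-- The tangent vector at the point with coordinates `u` in the chart at `x₀`, as a function of its
coordinates: the derivative of the inverse chart. -/
def chartFrame (d : ℕ) {M : Type*} [TopologicalSpace M] [ChartedSpace (EuclideanSpace ℝ (Fin d)) M]
    (x₀ : M) (u : EuclideanSpace ℝ (Fin d)) :
    EuclideanSpace ℝ (Fin d) →L[ℝ] TangentSpace (𝓡 d) ((extChartAt (𝓡 d) x₀).symm u) :=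
  mfderiv (𝓡 d) (𝓡 d) (extChartAt (𝓡 d) x₀).symm u

/-- The Riemannian metric in the coordinates of the chart `extChartAt (𝓡 d) x₀`: the inner product,
at the point with coordinates `u`, of the tangent vectors with coordinates `a` and `b`. -/
def chartMetric (d : ℕ) {M : Type*} [TopologicalSpace M] [ChartedSpace (EuclideanSpace ℝ (Fin d)) M]
    [IsManifold (𝓡 d) ∞ M] [RiemannianBundle (fun x : M => TangentSpace (𝓡 d) x)]
    (x₀ : M) (u a b : EuclideanSpace ℝ (Fin d)) : ℝ :=
  inner ℝ (chartFrame d x₀ u a) (chartFrame d x₀ u b)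

/-- The Christoffel symbols of the first kind of the Levi-Civita connection in the chart at `x₀`,
contracted with `a`, `b`, `c`:
`½ (∂_i g_{jk} + ∂_j g_{ik} - ∂_k g_{ij}) aⁱ bʲ cᵏ`. -/
def christoffel (d : ℕ) {M : Type*} [TopologicalSpace M] [ChartedSpace (EuclideanSpace ℝ (Fin d)) M]
    [IsManifold (𝓡 d) ∞ M] [RiemannianBundle (fun x : M => TangentSpace (𝓡 d) x)]
    (x₀ : M) (u a b c : EuclideanSpace ℝ (Fin d)) : ℝ :=
  (1 / 2 : ℝ) *
    (fderiv ℝ (fun p => chartMetric d x₀ p b c) u a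
      + fderiv ℝ (fun p => chartMetric d x₀ p a c) u b
      - fderiv ℝ (fun p => chartMetric d x₀ p a b) u c)

/-- The coordinates, in the chart at `x₀`, of a tangent vector at `x`: the derivative of the
chart. -/
def chartVec (d : ℕ) {M : Type*} [TopologicalSpace M] [ChartedSpace (EuclideanSpace ℝ (Fin d)) M]
    (x₀ x : M) : TangentSpace (𝓡 d) x →L[ℝ] EuclideanSpace ℝ (Fin d) :=
  mfderiv (𝓡 d) (𝓡 d) (extChartAt (𝓡 d) x₀) x

/-- The vector field `V` along the curve `γ : [0,1] → M` is parallel for the Levi-Civita connection: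
in coordinates `W' + Γ(γ', W) = 0` at all times. The equation at time `t` is tensorial, so it does
not matter in which of the charts around `γ t` it is written. -/
def IsParallelAlong {d : ℕ} {M : Type*} [TopologicalSpace M]
    [ChartedSpace (EuclideanSpace ℝ (Fin d)) M]
    [IsManifold (𝓡 d) ∞ M] [RiemannianBundle (fun x : M => TangentSpace (𝓡 d) x)]
    (γ : ℝ → M) (V : ∀ t : ℝ, TangentSpace (𝓡 d) (γ t)) : Prop :=
  ContinuousOn γ (Icc 0 1) ∧
  ∀ t ∈ Icc (0 : ℝ) 1, ∃ x₀ : M, γ t ∈ (extChartAt (𝓡 d) x₀).source ∧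
    ∃ u' W' : EuclideanSpace ℝ (Fin d),
      HasDerivWithinAt (fun s => extChartAt (𝓡 d) x₀ (γ s)) u' (Icc 0 1) t ∧
      HasDerivWithinAt (fun s => chartVec d x₀ (γ s) (V s)) W' (Icc 0 1) t ∧
      ∀ c : EuclideanSpace ℝ (Fin d),
        chartMetric d x₀ (extChartAt (𝓡 d) x₀ (γ t)) W' c
          + christoffel d x₀ (extChartAt (𝓡 d) x₀ (γ t)) u' (chartVec d x₀ (γ t) (V t)) c = 0

/-- `w` is the parallel transport of `v` along `γ : [0,1] → M`, from `γ 0` to `γ 1`. -/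
def IsParallelTransport {d : ℕ} {M : Type*} [TopologicalSpace M]
    [ChartedSpace (EuclideanSpace ℝ (Fin d)) M]
    [IsManifold (𝓡 d) ∞ M] [RiemannianBundle (fun x : M => TangentSpace (𝓡 d) x)]
    (γ : ℝ → M) (v : TangentSpace (𝓡 d) (γ 0)) (w : TangentSpace (𝓡 d) (γ 1)) : Prop :=
  ∃ V : ∀ t : ℝ, TangentSpace (𝓡 d) (γ t), IsParallelAlong γ V ∧ V 0 = v ∧ V 1 = w

/-- `γ : [0,1] → X` is a minimizing geodesic from `γ 0` to `γ 1`, parametrized proportionally to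
arc length. -/
def IsMinGeodesic {X : Type*} [MetricSpace X] (γ : ℝ → X) : Prop :=
  ∀ s ∈ Icc (0 : ℝ) 1, ∀ t ∈ Icc (0 : ℝ) 1, dist (γ s) (γ t) = |s - t| * dist (γ 0) (γ 1)

/-- `φ` is geodesically `μ`-strongly convex. -/
def GeodStronglyConvex {X : Type*} [MetricSpace X] (μ : ℝ) (φ : X → ℝ) : Prop :=
  ∀ γ : ℝ → X, IsMinGeodesic γ → ∀ t ∈ Icc (0 : ℝ) 1,
    φ (γ t) ≤ (1 - t) * φ (γ 0) + t * φ (γ 1)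
      - μ / 2 * (t * (1 - t)) * dist (γ 0) (γ 1) ^ 2

theorem tangentSpace_complete (d : ℕ) {M : Type*} [TopologicalSpace M]
    [ChartedSpace (EuclideanSpace ℝ (Fin d)) M]
    [IsManifold (𝓡 d) ∞ M] [RiemannianBundle (fun x : M => TangentSpace (𝓡 d) x)] (x : M) :
    CompleteSpace (TangentSpace (𝓡 d) x) :=
  haveI : FiniteDimensional ℝ (TangentSpace (𝓡 d) x) :=
    inferInstanceAs (FiniteDimensional ℝ (EuclideanSpace ℝ (Fin d)))
  FiniteDimensional.complete ℝ _

/-- The Riemannian gradient: the vector dual to the differential (Riesz representation). -/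
def riemGrad (d : ℕ) {M : Type*} [TopologicalSpace M] [ChartedSpace (EuclideanSpace ℝ (Fin d)) M]
    [IsManifold (𝓡 d) ∞ M] [RiemannianBundle (fun x : M => TangentSpace (𝓡 d) x)]
    (φ : M → ℝ) (x : M) : TangentSpace (𝓡 d) x :=
  haveI : CompleteSpace (TangentSpace (𝓡 d) x) := tangentSpace_complete d x
  (InnerProductSpace.toDual ℝ (TangentSpace (𝓡 d) x)).symm (mfderiv (𝓡 d) 𝓘(ℝ, ℝ) φ x)

/-- The gradient of `F` on the Riemannian product `M × N` is `l`-Lipschitz: along any minimizing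
geodesic of `M × N` (a pair of minimizing geodesics `γ` of `M` and `σ` of `N`) the transported
gradient differs from the gradient at the endpoint by at most `l` times the distance. Distance,
tangent norm and parallel transport are those of the product metric. -/
def LipschitzGradient (m n : ℕ)
    {M : Type*} [MetricSpace M] [ChartedSpace (EuclideanSpace ℝ (Fin m)) M]
    [IsManifold (𝓡 m) ∞ M] [RiemannianBundle (fun x : M => TangentSpace (𝓡 m) x)]
    {N : Type*} [MetricSpace N] [ChartedSpace (EuclideanSpace ℝ (Fin n)) N]
    [IsManifold (𝓡 n) ∞ N] [RiemannianBundle (fun y : N => TangentSpace (𝓡 n) y)]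
    (l : ℝ) (F : M × N → ℝ) : Prop :=
  ∀ (γ : ℝ → M) (σ : ℝ → N), IsMinGeodesic γ → IsMinGeodesic σ →
    ∀ (v : TangentSpace (𝓡 m) (γ 1)) (w : TangentSpace (𝓡 n) (σ 1)),
      IsParallelTransport γ (riemGrad m (fun x => F (x, σ 0)) (γ 0)) v →
      IsParallelTransport σ (riemGrad n (fun y => F (γ 0, y)) (σ 0)) w →
      Real.sqrt (‖v - riemGrad m (fun x => F (x, σ 1)) (γ 1)‖ ^ 2
          + ‖w - riemGrad n (fun y => F (γ 1, y)) (σ 1)‖ ^ 2)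
        ≤ l * Real.sqrt (dist (γ 0) (γ 1) ^ 2 + dist (σ 0) (σ 1) ^ 2)

/-- The Lagrangian `L_λ(x, y) = f(x, y) + λ (g(x, y) - g*(x))`, where `g*(x) = min_y g(x, y)`. -/
def lagrangian {M N : Type*} (f g : M × N → ℝ) (lam : ℝ) (x : M) (y : N) : ℝ :=
  f (x, y) + lam * (g (x, y) - ⨅ z : N, g (x, z))

end RiemBilevel

end

/-! Write φ_λ(x, ·) = f(x, ·) + λ g(x, ·). Along minimizing geodesics in the second factor, the
Lipschitz gradient keeps f within a quadratic error of its linear interpolation, so φ_λ(x, ·) is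
strongly convex with modulus λμ_g - l_{f,1} ≥ λμ_g/2. On a complete manifold this gives a unique
minimizer and quadratic growth away from it (`GeodStronglyConvex.existsUnique_isMinOn`,
`GeodStronglyConvex.growth`).

The distance bounds come from playing two growth inequalities against each other through the
intermediate point a = y*_{λ₁}(x₂). Between y*_{λ₁}(x₁) and a, the sum of the two inequalities is a
mixed difference of φ_{λ₁} in x and y, bounded by `LipschitzGradient.abs_mixed_difference_le`; here
μ_g ≤ l_{g,1} turns l_{f,1} ≤ λ₁μ_g/2 into a multiple of l_{g,1}. Between a and y*_{λ₂}(x₂), the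
combination with weights λ₂ and λ₁ cancels g and leaves (λ₂ - λ₁) times an increment of f, which is
l_{f,0}-Lipschitz in y. The bound for y*_λ versus y* uses the growth of g alone.

The bulk of the file is Riemannian geometry. Geodesics are defined metrically and the gradient
condition speaks of parallel transport, so three facts are needed: minimizing geodesics exist
(Hopf-Rinow), they are C¹ with constant speed in the interior, and short pieces carry parallel
fields whose inner product with the velocity is constant. The last two are
`IsMinGeodesic.exists_local_transport`. Regularity comes from comparing the distance in a chart with
the metric frozen at a point: the parallelogram identity then makes second differences small.
Constancy of the inner product comes from a du Bois-Reymond argument in the first variation of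
energy, which needs only C¹ regularity and no geodesic equation. -/

noncomputable section

namespace RiemBilevel

open Filter Topology

/-! ### Hopf-Rinow in metric spaces: proper balls and minimizing geodesics. -/

section Metric

variable {X : Type*} [MetricSpace X]

/-- Approximate betweenness, the form in which completeness and the length-space property enter the
Hopf-Rinow theorem. -/
def HasApproxBetween (X : Type*) [MetricSpace X] : Prop :=
  ∀ x y : X, ∀ r : ℝ, 0 ≤ r → r ≤ dist x y → ∀ ε > 0,
    ∃ z : X, dist x z = r ∧ dist z y ≤ dist x y - r + ε

/-- A point y beyond the radius has a point z on the sphere of radius r with d(z, y) ≤ d(x, y) - r +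
δ/2, and the first two terms contribute at most δ/2. -/
theorem HasApproxBetween.closedBall_subset_cthickening (hX : HasApproxBetween X) {x : X} {r δ : ℝ}
    (hr : 0 ≤ r) (hδ : 0 < δ) :
    Metric.closedBall x (r + δ / 2) ⊆ Metric.cthickening δ (Metric.closedBall x r) := by
  intro y hy
  rw [Metric.mem_closedBall, dist_comm] at hy
  by_cases h : dist x y ≤ r
  · exact Metric.self_subset_cthickening _ (by rwa [Metric.mem_closedBall, dist_comm])
  · push Not at h
    obtain ⟨z, hz1, hz2⟩ := hX x y r hr h.le (δ / 2) (by positivity)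
    refine Metric.mem_cthickening_of_dist_le y z δ _ ?_ ?_
    · rw [Metric.mem_closedBall, dist_comm, hz1]
    · rw [dist_comm]; linarith

/-- Continuity argument on the set of radii with compact ball: local compactness lets any such
radius grow, and completeness puts a finite supremum into the set, so the set is unbounded. -/
theorem HasApproxBetween.isCompact_closedBall [CompleteSpace X] [LocallyCompactSpace X]
    (hX : HasApproxBetween X) (x : X) (R : ℝ) : IsCompact (Metric.closedBall x R) := by
  set S : Set ℝ := {r | 0 ≤ r ∧ IsCompact (Metric.closedBall x r)} with hS
  have h0 : (0 : ℝ) ∈ S := ⟨le_rfl, by simp⟩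
  have hmono : ∀ r ∈ S, ∀ r' ≤ r, IsCompact (Metric.closedBall x r') := fun r hr r' h =>
    hr.2.of_isClosed_subset Metric.isClosed_closedBall (Metric.closedBall_subset_closedBall h)
  have hup : ∀ r ∈ S, ∃ δ > 0, r + δ ∈ S := by
    rintro r ⟨hr0, hr⟩
    obtain ⟨δ, hδ, hc⟩ := hr.exists_isCompact_cthickening
    exact ⟨δ / 2, by positivity, by positivity, hc.of_isClosed_subset Metric.isClosed_closedBall
      (hX.closedBall_subset_cthickening hr0 hδ)⟩
  by_cases hb : BddAbove S
  · exfalso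
    set s := sSup S with hs
    have hs0 : 0 ≤ s := le_csSup hb h0
    suffices hsS : s ∈ S by
      obtain ⟨δ, hδ, h⟩ := hup s hsS
      linarith [le_csSup hb h]
    refine ⟨hs0, ?_⟩
    refine isCompact_iff_totallyBounded_isComplete.2 ⟨?_, Metric.isClosed_closedBall.isComplete⟩
    rw [Metric.totallyBounded_iff]
    intro ε hε
    -- The ball of radius s lies in the ε/4-thickening of a compact ball of radius r, so an ε/2-net
    -- of the latter is an ε-net of the former.
    have hbelow : ∃ r, 0 ≤ r ∧ s ≤ r + ε / 4 / 2 ∧ IsCompact (Metric.closedBall x r) := by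
      by_cases h : s - ε / 4 / 2 ≤ 0
      · exact ⟨0, le_rfl, by linarith, h0.2⟩
      · obtain ⟨r', hr', hlt⟩ := exists_lt_of_lt_csSup ⟨0, h0⟩ (show s - ε / 4 / 2 < sSup S by
          rw [← hs]; linarith)
        exact ⟨r', hr'.1, by linarith, hr'.2⟩
    obtain ⟨r, hr0, hr1, hrc⟩ := hbelow
    obtain ⟨t, htf, ht⟩ := Metric.totallyBounded_iff.1 hrc.totallyBounded (ε / 2) (by positivity)
    refine ⟨t, htf, fun y hy => ?_⟩
    have hy2 := hX.closedBall_subset_cthickening hr0 (show 0 < ε / 4 by positivity)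
      (Metric.closedBall_subset_closedBall hr1 hy)
    have hy3 := Metric.cthickening_subset_thickening' (show 0 < ε / 2 by positivity)
      (show ε / 4 < ε / 2 by linarith) _ hy2
    obtain ⟨z, hz, hzy⟩ := Metric.mem_thickening_iff.1 hy3
    have := ht hz
    simp only [mem_iUnion, Metric.mem_ball] at this ⊢
    obtain ⟨w, hw, hwz⟩ := this
    exact ⟨w, hw, by linarith [dist_triangle y z w]⟩
  · rw [not_bddAbove_iff] at hb
    obtain ⟨r, hr, hlt⟩ := hb R
    exact hmono r hr R hlt.le

/-- The distance to y attains its minimum on the compact sphere of radius r, and the approximate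
points show that this minimum is at most d(x, y) - r. -/
theorem HasApproxBetween.exists_between [ProperSpace X] (hX : HasApproxBetween X) (x y : X) {r : ℝ}
    (hr : 0 ≤ r) (hr' : r ≤ dist x y) : ∃ z : X, dist x z = r ∧ dist z y = dist x y - r := by
  have hne : (Metric.sphere x r).Nonempty := by
    obtain ⟨z, hz, -⟩ := hX x y r hr hr' 1 one_pos
    exact ⟨z, by rw [Metric.mem_sphere, dist_comm, hz]⟩
  obtain ⟨z, hz, hmin⟩ := (isCompact_sphere x r).exists_isMinOn hne
    (f := fun z => dist z y) (by fun_prop)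
  rw [Metric.mem_sphere, dist_comm] at hz
  refine ⟨z, hz, le_antisymm ?_ (by linarith [dist_triangle x z y])⟩
  refine le_of_forall_pos_le_add fun ε hε => ?_
  obtain ⟨w, hw, hw'⟩ := hX x y r hr hr' ε hε
  exact (hmin (show w ∈ Metric.sphere x r by rw [Metric.mem_sphere, dist_comm, hw])).trans hw'

/-- Repeatedly step a distance at most d(x, y)/(n + 1) closer to y. After n + 1 steps y is reached,
so no step can be wasted; the bound between all pairs is the triangle inequality. -/
theorem HasApproxBetween.exists_sampled_geodesic [ProperSpace X] (hX : HasApproxBetween X)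
    (x y : X) (n : ℕ) : ∃ z : ℕ → X, z 0 = x ∧ z (n + 1) = y ∧
      ∀ j k : ℕ, dist (z j) (z k) ≤ |(j : ℝ) - k| * (dist x y / (n + 1)) := by
  set e := dist x y / (n + 1) with he
  have he0 : 0 ≤ e := by positivity
  have hstep : ∀ z : X, ∃ z' : X, dist z z' ≤ e ∧ dist z' y ≤ max (dist z y - e) 0 := by
    intro z
    rcases le_total e (dist z y) with h | h
    · obtain ⟨z', h1, h2⟩ := hX.exists_between z y he0 h
      exact ⟨z', h1.le, by rw [h2]; exact le_max_left _ _⟩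
    · exact ⟨y, h, by simp⟩
  choose F hF1 hF2 using hstep
  set z : ℕ → X := fun k => Nat.rec x (fun _ w => F w) k with hz
  have hzs : ∀ k, z (k + 1) = F (z k) := fun k => rfl
  have hd : ∀ k : ℕ, dist (z k) y ≤ max (dist x y - k * e) 0 := by
    intro k
    induction k with
    | zero => simp [hz]
    | succ k ih =>
      rw [hzs]
      refine (hF2 _).trans (max_le ?_ (le_max_right _ _))
      push_cast
      rcases le_max_iff.1 ih with h | h
      · exact le_max_of_le_left (by linarith)
      · exact le_max_of_le_right (by linarith)
  have hle : ∀ j k : ℕ, dist (z j) (z (j + k)) ≤ k * e := by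
    intro j k
    induction k with
    | zero => simp
    | succ k ih =>
      have := hF1 (z (j + k))
      rw [← hzs] at this
      push_cast
      have h3 := dist_triangle (z j) (z (j + k)) (z (j + (k + 1)))
      rw [← add_assoc] at h3 ⊢
      linarith
  refine ⟨z, rfl, ?_, ?_⟩
  · have h := hd (n + 1)
    have h2 : dist x y - ((n + 1 : ℕ) : ℝ) * e = 0 := by
      rw [he]; push_cast; field_simp; ring
    rw [h2, max_self] at h
    exact dist_le_zero.1 h
  · intro j k
    rcases le_total j k with h | h
    · obtain ⟨i, rfl⟩ := Nat.exists_eq_add_of_le h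
      refine (hle j i).trans (le_of_eq ?_)
      push_cast
      rw [show (j : ℝ) - (j + i) = -i by ring, abs_neg, Nat.abs_cast]
    · obtain ⟨i, rfl⟩ := Nat.exists_eq_add_of_le h
      rw [dist_comm]
      refine (hle k i).trans (le_of_eq ?_)
      push_cast
      rw [show (k : ℝ) + i - k = i by ring, Nat.abs_cast]

/-- A curve that is Lipschitz with the distance of its end points as constant is minimizing. -/
theorem isMinGeodesic_of_dist_le {γ : ℝ → X}
    (h : ∀ s ∈ Icc (0 : ℝ) 1, ∀ t ∈ Icc (0 : ℝ) 1,
      dist (γ s) (γ t) ≤ |s - t| * dist (γ 0) (γ 1)) : IsMinGeodesic γ := by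
  have key : ∀ s ∈ Icc (0 : ℝ) 1, ∀ t ∈ Icc (0 : ℝ) 1, s ≤ t →
      dist (γ s) (γ t) = |s - t| * dist (γ 0) (γ 1) := by
    intro s hs t ht hst
    refine le_antisymm (h s hs t ht) ?_
    -- The outer pieces have length at most s·D and (1 - t)·D, which leaves at least (t - s)·D for
    -- the middle one.
    have h1 := h 0 ⟨le_rfl, zero_le_one⟩ s hs
    have h2 := h t ht 1 ⟨zero_le_one, le_rfl⟩
    rw [abs_of_nonpos (by linarith [hs.1])] at h1
    rw [abs_of_nonpos (by linarith [ht.2])] at h2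
    rw [abs_of_nonpos (by linarith)]
    linarith [dist_triangle4 (γ 0) (γ s) (γ t) (γ 1)]
  intro s hs t ht
  rcases le_total s t with hst | hst
  · exact key s hs t ht hst
  · rw [dist_comm, abs_sub_comm]; exact key t ht s hs hst

/-- The step curves through the sampled points are Lipschitz up to an error of order 1/(n + 1). A
pointwise limit along a free ultrafilter exists in the proper space and removes the error, with no
subsequence to extract. -/
theorem HasApproxBetween.exists_isMinGeodesic [ProperSpace X] (hX : HasApproxBetween X) (x y : X) :
    ∃ γ : ℝ → X, IsMinGeodesic γ ∧ γ 0 = x ∧ γ 1 = y := by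
  set D := dist x y with hD
  choose z hz0 hz1 hz using hX.exists_sampled_geodesic x y
  set G : ℕ → ℝ → X := fun n t => z n ⌊t * (n + 1)⌋₊ with hG
  have hG0 : ∀ n, G n 0 = x := fun n => by simp [hG, hz0]
  have hG1 : ∀ n, G n 1 = y := fun n => by
    simp only [hG, one_mul]
    rw [← hz1 n]; congr 1
    exact_mod_cast Nat.floor_natCast (R := ℝ) (n + 1)
  have hGd : ∀ n, ∀ s ∈ Icc (0 : ℝ) 1, ∀ t ∈ Icc (0 : ℝ) 1,
      dist (G n s) (G n t) ≤ (|s - t| + 1 / (n + 1)) * D := by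
    intro n s hs t ht
    refine (hz n _ _).trans ?_
    have hn : (0 : ℝ) < n + 1 := by positivity
    have hfl : |(⌊s * ((n : ℝ) + 1)⌋₊ : ℝ) - ⌊t * ((n : ℝ) + 1)⌋₊| ≤ |s - t| * (n + 1) + 1 := by
      have a1 := Nat.floor_le (mul_nonneg hs.1 hn.le)
      have a2 := Nat.lt_floor_add_one (s * ((n : ℝ) + 1))
      have b1 := Nat.floor_le (mul_nonneg ht.1 hn.le)
      have b2 := Nat.lt_floor_add_one (t * ((n : ℝ) + 1))
      have c1 : (s - t) * (n + 1) ≤ |s - t| * (n + 1) := by gcongr; exact le_abs_self _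
      have c2 : -(s - t) * (n + 1) ≤ |s - t| * (n + 1) := by gcongr; exact neg_le_abs _
      rw [abs_le]; constructor <;> linarith
    calc _ ≤ (|s - t| * (n + 1) + 1) * (D / (n + 1)) := by gcongr
      _ = _ := by field_simp
  have hlim : ∀ t : ℝ, ∃ p : X, t ∈ Icc (0 : ℝ) 1 →
      Tendsto (fun n => G n t) (hyperfilter ℕ : Filter ℕ) (𝓝 p) := by
    intro t
    by_cases ht : t ∈ Icc (0 : ℝ) 1
    · have hmem : ∀ n, G n t ∈ Metric.closedBall x (2 * D) := by
        intro n
        have := hGd n t ht 0 ⟨le_rfl, zero_le_one⟩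
        rw [hG0] at this
        refine this.trans ?_
        have h1 : |t - 0| ≤ 1 := by rw [sub_zero, abs_of_nonneg ht.1]; exact ht.2
        have h2 : 1 / ((n : ℝ) + 1) ≤ 1 := by
          rw [div_le_one (by positivity)]; linarith [Nat.cast_nonneg (α := ℝ) n]
        gcongr
        linarith
      obtain ⟨p, -, hp⟩ := (ProperSpace.isCompact_closedBall x (2 * D)).ultrafilter_le_nhds
        ((hyperfilter ℕ).map fun n => G n t)
        (le_principal_iff.2 (Filter.mem_map.2 (Eventually.of_forall hmem)))
      exact ⟨p, fun _ => hp⟩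
    · exact ⟨x, fun h => absurd h ht⟩
  choose γ hγ using hlim
  have e0 : γ 0 = x := tendsto_nhds_unique (hγ 0 ⟨le_rfl, zero_le_one⟩) (by simp [hG0])
  have e1 : γ 1 = y := tendsto_nhds_unique (hγ 1 ⟨zero_le_one, le_rfl⟩) (by simp [hG1])
  refine ⟨γ, isMinGeodesic_of_dist_le fun s hs t ht => ?_, e0, e1⟩
  rw [e0, e1]
  refine le_of_tendsto_of_tendsto ((hγ s hs).dist (hγ t ht)) ?_
    (Eventually.of_forall fun n => hGd n s hs t ht)
  have : Tendsto (fun n : ℕ => (|s - t| + 1 / ((n : ℝ) + 1)) * D) atTop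
      (𝓝 ((|s - t| + 0) * D)) :=
    (tendsto_const_nhds.add tendsto_one_div_add_atTop_nhds_zero_nat).mul_const D
  rw [add_zero] at this
  exact this.mono_left Nat.hyperfilter_le_atTop

theorem IsMinGeodesic.continuousOn {γ : ℝ → X} (h : IsMinGeodesic γ) :
    ContinuousOn γ (Icc 0 1) := by
  have : LipschitzOnWith (Real.toNNReal (dist (γ 0) (γ 1))) γ (Icc 0 1) := by
    refine LipschitzOnWith.of_dist_le_mul fun s hs t ht => ?_
    rw [h s hs t ht, Real.coe_toNNReal _ dist_nonneg, mul_comm, Real.dist_eq]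
  exact this.continuousOn

theorem isMinGeodesic_const (x : X) : IsMinGeodesic fun _ : ℝ => x := by
  intro s _ t _; simp

theorem IsMinGeodesic.restrict {γ : ℝ → X} (h : IsMinGeodesic γ) {a b : ℝ} (ha : 0 ≤ a)
    (hab : a ≤ b) (hb : b ≤ 1) : IsMinGeodesic fun τ => γ (a + τ * (b - a)) := by
  have hmem : ∀ τ ∈ Icc (0 : ℝ) 1, a + τ * (b - a) ∈ Icc (0 : ℝ) 1 := fun τ hτ =>
    ⟨by nlinarith [hτ.1], by nlinarith [hτ.2]⟩
  intro s hs t ht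
  simp only
  rw [h _ (hmem s hs) _ (hmem t ht), h _ (hmem 0 (by simp)) _ (hmem 1 (by simp))]
  rw [show a + s * (b - a) - (a + t * (b - a)) = (s - t) * (b - a) by ring,
    show a + 0 * (b - a) - (a + 1 * (b - a)) = -(b - a) by ring, abs_mul, abs_neg]
  ring

/-! ### Strongly convex functions: growth and minimizers. -/

section Convex

variable {κ : ℝ} {φ : X → ℝ}

/-- Quadratic growth away from a minimizer. -/
theorem GeodStronglyConvex.growth
    (hgeo : ∀ x y : X, ∃ γ : ℝ → X, IsMinGeodesic γ ∧ γ 0 = x ∧ γ 1 = y)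
    (hφ : GeodStronglyConvex κ φ) {y₀ : X} (hy₀ : IsMinOn φ univ y₀) (y : X) :
    φ y₀ + κ / 2 * dist y₀ y ^ 2 ≤ φ y := by
  obtain ⟨γ, hγ, h0, h1⟩ := hgeo y₀ y
  have key : ∀ t ∈ Ioo (0 : ℝ) 1, φ y₀ + κ / 2 * (1 - t) * dist y₀ y ^ 2 ≤ φ y := by
    intro t ht
    have h := hφ γ hγ t ⟨ht.1.le, ht.2.le⟩
    rw [h0, h1] at h
    have h2 : φ y₀ ≤ φ (γ t) := hy₀ (mem_univ _)
    -- Minimality at y₀ cancels the terms of order zero in t; after division by t, letting t tend to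
    -- 0 recovers the full constant κ/2.
    have h3 : t * (φ y₀ + κ / 2 * (1 - t) * dist y₀ y ^ 2) ≤ t * φ y := by linarith
    exact le_of_mul_le_mul_left h3 ht.1
  have hlim : Tendsto (fun t : ℝ => φ y₀ + κ / 2 * (1 - t) * dist y₀ y ^ 2) (𝓝[>] 0)
      (𝓝 (φ y₀ + κ / 2 * (1 - 0) * dist y₀ y ^ 2)) :=
    (Continuous.tendsto (by fun_prop) 0).mono_left nhdsWithin_le_nhds
  rw [sub_zero, mul_one] at hlim
  refine le_of_tendsto hlim ?_
  filter_upwards [Ioo_mem_nhdsGT (zero_lt_one' ℝ)] with t ht using key t ht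

/-- Coercivity is derived: the minimum over the unit ball bounds φ below at distance 1 from y₀ on
any geodesic, and strong convexity then forces φ ≥ φ(y₀) far away. -/
theorem GeodStronglyConvex.existsUnique_isMinOn [ProperSpace X] [Nonempty X]
    (hgeo : ∀ x y : X, ∃ γ : ℝ → X, IsMinGeodesic γ ∧ γ 0 = x ∧ γ 1 = y)
    (hκ : 0 < κ) (hφ : GeodStronglyConvex κ φ) (hc : Continuous φ) :
    ∃! y, IsMinOn φ univ y := by
  obtain ⟨y₀⟩ := ‹Nonempty X›
  obtain ⟨b, hb, hbmin⟩ := (isCompact_closedBall y₀ 1).exists_isMinOn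
    ⟨y₀, Metric.mem_closedBall_self zero_le_one⟩ hc.continuousOn
  have hb0 : φ b ≤ φ y₀ := hbmin (Metric.mem_closedBall_self zero_le_one)
  -- Convexity at distance 1 gives φ(y) ≥ φ(y₀) + r(κ(r - 1)/2 - (φ(y₀) - φ(b))); for r > R the
  -- bracket is nonnegative.
  set R := 2 + 2 * (φ y₀ - φ b) / κ with hR
  have hR1 : 1 < R := by
    have : 0 ≤ 2 * (φ y₀ - φ b) / κ := div_nonneg (by linarith) hκ.le
    linarith
  have hout : ∀ y, R < dist y₀ y → φ y₀ ≤ φ y := by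
    intro y hy
    set r := dist y₀ y
    have hr : 0 < r := by linarith
    obtain ⟨γ, hγ, h0, h1⟩ := hgeo y₀ y
    have hmem : 1 / r ∈ Icc (0 : ℝ) 1 := ⟨by positivity, by rw [div_le_one hr]; linarith⟩
    have h := hφ γ hγ (1 / r) hmem
    have hd := hγ 0 (by simp) (1 / r) hmem
    rw [h0, h1, zero_sub, abs_neg, abs_of_nonneg hmem.1] at hd
    have hd1 : dist y₀ (γ (1 / r)) = 1 := by rw [hd]; exact one_div_mul_cancel hr.ne'
    have hlow : φ b ≤ φ (γ (1 / r)) := hbmin (by rw [Metric.mem_closedBall, dist_comm, hd1])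
    rw [h0, h1] at h
    have h2 : φ b ≤ (1 - 1 / r) * φ y₀ + 1 / r * φ y - κ / 2 * (1 / r * (1 - 1 / r)) * r ^ 2 :=
      hlow.trans h
    have h3 : r * φ b ≤ (r - 1) * φ y₀ + φ y - κ / 2 * (r - 1) * r := by
      have := mul_le_mul_of_nonneg_left h2 hr.le
      calc _ ≤ _ := this
        _ = _ := by field_simp
    have h4 : φ y₀ - φ b ≤ κ / 2 * (r - 1) := by
      have : 2 * (φ y₀ - φ b) / κ ≤ r - 1 := by linarith
      rw [div_le_iff₀ hκ] at this
      linarith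
    nlinarith
  obtain ⟨y₁, hy₁, hmin⟩ := (isCompact_closedBall y₀ R).exists_isMinOn
    ⟨y₀, Metric.mem_closedBall_self (by linarith)⟩ hc.continuousOn
  have hmin' : IsMinOn φ univ y₁ := by
    intro y _
    by_cases h : dist y₀ y ≤ R
    · exact hmin (by rwa [Metric.mem_closedBall, dist_comm])
    · push Not at h
      exact (show φ y₁ ≤ φ y₀ from hmin (Metric.mem_closedBall_self (by linarith))).trans (hout y h)
  refine ⟨y₁, hmin', fun y hy => ?_⟩
  have h1 := hφ.growth hgeo hmin' y
  have h2 : φ y ≤ φ y₁ := hy (mem_univ _)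
  have h3 : dist y₁ y ^ 2 ≤ 0 := by
    by_contra h
    push Not at h
    nlinarith [mul_pos hκ h]
  have : dist y₁ y = 0 := by
    have := sq_nonneg (dist y₁ y)
    exact pow_eq_zero_iff two_ne_zero |>.1 (le_antisymm h3 this)
  exact (dist_eq_zero.1 this).symm

end Convex

end Metric

/-! ### Riemannian metrics and length distances in coordinates. -/

section Coordinates

open MeasureTheory intervalIntegral

variable {E : Type*} [NormedAddCommGroup E] [NormedSpace ℝ E]

/-- `c` is a `C¹` curve on `[a, b]` with derivative `c'`. -/
structure IsC1Curve (c c' : ℝ → E) (a b : ℝ) : Prop where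
  hasDeriv : ∀ t ∈ Icc a b, HasDerivWithinAt c (c' t) (Icc a b) t
  continuousOn_deriv : ContinuousOn c' (Icc a b)

theorem IsC1Curve.continuousOn {c c' : ℝ → E} {a b : ℝ} (h : IsC1Curve c c' a b) :
    ContinuousOn c (Icc a b) := fun t ht => (h.hasDeriv t ht).continuousWithinAt

theorem IsC1Curve.mono {c c' : ℝ → E} {a b a₁ b₁ : ℝ} (h : IsC1Curve c c' a b) (ha : a ≤ a₁)
    (hb : b₁ ≤ b) : IsC1Curve c c' a₁ b₁ :=
  ⟨fun t ht => (h.hasDeriv t (Icc_subset_Icc ha hb ht)).mono (Icc_subset_Icc ha hb),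
    h.continuousOn_deriv.mono (Icc_subset_Icc ha hb)⟩

theorem IsC1Curve.integral_eq [CompleteSpace E] {c c' : ℝ → E} {a b : ℝ} (h : IsC1Curve c c' a b)
    (hab : a ≤ b) : ∫ t in a..b, c' t = c b - c a := by
  refine integral_eq_sub_of_hasDeriv_right_of_le hab h.continuousOn (fun t ht => ?_)
    (h.continuousOn_deriv.intervalIntegrable_of_Icc hab)
  exact (h.hasDeriv t (Ioo_subset_Icc_self ht)).mono_of_mem_nhdsWithin
    (mem_nhdsWithin_of_mem_nhds (Icc_mem_nhds ht.1 ht.2))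

/-- The square root of a quadratic form: the length of `a` for the bilinear form `b`. -/
def formNorm (b : E →L[ℝ] E →L[ℝ] ℝ) (a : E) : ℝ := Real.sqrt (b a a)

/-- A Riemannian metric of class `C^∞` in coordinates, on an open set `U`. -/
structure IsCoordMetric (U : Set E) (B : E → E →L[ℝ] E →L[ℝ] ℝ) : Prop where
  isOpen : IsOpen U
  contDiffOn : ContDiffOn ℝ ∞ B U
  symm : ∀ p ∈ U, ∀ a b, B p a b = B p b a
  pos : ∀ p ∈ U, ∀ a, a ≠ 0 → 0 < B p a a

namespace IsCoordMetric

variable {U : Set E} {B : E → E →L[ℝ] E →L[ℝ] ℝ}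

theorem nonneg (h : IsCoordMetric U B) {p : E} (hp : p ∈ U) (a : E) : 0 ≤ B p a a := by
  rcases eq_or_ne a 0 with rfl | ha
  · simp
  · exact (h.pos p hp a ha).le

theorem sq_le (h : IsCoordMetric U B) {p : E} (hp : p ∈ U) (a b : E) :
    B p a b ^ 2 ≤ B p a a * B p b b := by
  have key : ∀ s : ℝ, 0 ≤ B p a a + 2 * s * B p a b + s ^ 2 * B p b b := by
    intro s
    have := h.nonneg hp (a + s • b)
    simp only [map_add, map_smul, add_apply, smul_apply,
      smul_eq_mul, h.symm p hp b a] at this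
    linarith
  have := discrim_le_zero (a := B p b b) (b := 2 * B p a b) (c := B p a a)
    (fun s => by have := key s; linarith)
  rw [discrim] at this
  linarith

theorem le_formNorm_mul (h : IsCoordMetric U B) {p : E} (hp : p ∈ U) (a b : E) :
    B p a b ≤ formNorm (B p) a * formNorm (B p) b := by
  rw [formNorm, formNorm, ← Real.sqrt_mul (h.nonneg hp a)]
  exact Real.le_sqrt_of_sq_le (h.sq_le hp a b)

set_option maxSynthPendingDepth 3 in
/-- Uniform ellipticity and the Lipschitz condition near a point of the coordinate domain. -/
theorem exists_bounds [FiniteDimensional ℝ E] (h : IsCoordMetric U B) {p₀ : E} (hp₀ : p₀ ∈ U) :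
    ∃ r > 0, ∃ m > 0, ∃ K > 0, Metric.ball p₀ r ⊆ U ∧
      (∀ p ∈ Metric.ball p₀ r, ∀ a, m * ‖a‖ ^ 2 ≤ B p a a) ∧
      (∀ p ∈ Metric.ball p₀ r, ∀ a, B p a a ≤ K * ‖a‖ ^ 2) ∧
      ∀ p ∈ Metric.ball p₀ r, ∀ q ∈ Metric.ball p₀ r, ∀ a,
        B p a a ≤ B q a a + K * ‖p - q‖ * ‖a‖ ^ 2 := by
  obtain ⟨m, hm, hlow⟩ : ∃ m > 0, ∀ a, m * ‖a‖ ^ 2 ≤ B p₀ a a := by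
    -- The unit sphere is empty when E is the zero space.
    rcases (Metric.sphere (0 : E) 1).eq_empty_or_nonempty with he | hne
    · refine ⟨1, one_pos, fun a => ?_⟩
      rcases eq_or_ne a 0 with rfl | ha
      · simp
      · have : (‖a‖⁻¹ • a) ∈ Metric.sphere (0 : E) 1 := by
          simp [norm_smul, ha]
        rw [he] at this; exact this.elim
    · obtain ⟨w, hw, hmin⟩ := (isCompact_sphere (0 : E) 1).exists_isMinOn hne
        (f := fun a => B p₀ a a) ((B p₀).continuous.clm_apply continuous_id).continuousOn
      have hw0 : w ≠ 0 := by rintro rfl; simp at hw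
      refine ⟨B p₀ w w, h.pos p₀ hp₀ w hw0, fun a => ?_⟩
      rcases eq_or_ne a 0 with rfl | ha
      · simp
      have hmem : (‖a‖⁻¹ • a) ∈ Metric.sphere (0 : E) 1 := by
        simp [norm_smul, ha]
      have := hmin hmem
      simp only [mem_ofPred_eq, map_smul, smul_apply, smul_eq_mul] at this
      have hn : 0 < ‖a‖ := norm_pos_iff.2 ha
      calc B p₀ w w * ‖a‖ ^ 2 ≤ (‖a‖⁻¹ * (‖a‖⁻¹ * B p₀ a a)) * ‖a‖ ^ 2 := by gcongr
        _ = B p₀ a a := by field_simp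
  have hcd : ContDiffAt ℝ 1 B p₀ :=
    (h.contDiffOn.contDiffAt (h.isOpen.mem_nhds hp₀)).of_le (by exact_mod_cast le_top)
  obtain ⟨K₀, t, ht, hLip⟩ := hcd.exists_lipschitzOnWith
  obtain ⟨r₁, hr₁, hr₁t⟩ := Metric.mem_nhds_iff.1 (inter_mem ht (h.isOpen.mem_nhds hp₀))
  -- The last entry makes the variation of B at most m/2, so half of the ellipticity constant
  -- survives; the entry 1 serves the upper bound.
  set r := min r₁ (min 1 (m / 2 / (K₀ + 1))) with hr
  have hK1 : (0 : ℝ) < K₀ + 1 := by positivity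
  have hr0 : 0 < r := by positivity
  have hsub : Metric.ball p₀ r ⊆ t ∩ U :=
    (Metric.ball_subset_ball (min_le_left _ _)).trans hr₁t
  have hdiff : ∀ p ∈ Metric.ball p₀ r, ∀ q ∈ Metric.ball p₀ r, ∀ a,
      |B p a a - B q a a| ≤ K₀ * ‖p - q‖ * ‖a‖ ^ 2 := by
    intro p hp q hq a
    have h1 := hLip.dist_le_mul p (hsub hp).1 q (hsub hq).1
    rw [dist_eq_norm, dist_eq_norm] at h1
    have h2 : B p a a - B q a a = (B p - B q) a a := by simp
    rw [h2, ← Real.norm_eq_abs]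
    calc _ ≤ ‖B p - B q‖ * ‖a‖ * ‖a‖ := ContinuousLinearMap.le_opNorm₂ _ _ _
      _ ≤ (K₀ * ‖p - q‖) * ‖a‖ * ‖a‖ := by gcongr
      _ = _ := by ring
  have hp₀r : p₀ ∈ Metric.ball p₀ r := Metric.mem_ball_self hr0
  refine ⟨r, hr0, m / 2, by positivity, K₀ + ‖B p₀‖ + 1, by positivity,
    fun p hp => (hsub hp).2, fun p hp a => ?_, fun p hp a => ?_, fun p hp q hq a => ?_⟩
  · have h1 := (abs_le.1 (hdiff p hp p₀ hp₀r a)).1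
    have h2 : ‖p - p₀‖ ≤ m / 2 / (K₀ + 1) := by
      rw [← dist_eq_norm]
      exact (Metric.mem_ball.1 hp).le.trans ((min_le_right _ _).trans (min_le_right _ _))
    have h3 : K₀ * ‖p - p₀‖ ≤ m / 2 := by
      rw [le_div_iff₀ hK1] at h2
      nlinarith [norm_nonneg (p - p₀)]
    have h4 := mul_le_mul_of_nonneg_right h3 (sq_nonneg ‖a‖)
    linarith [hlow a]
  · have h1 := (abs_le.1 (hdiff p hp p₀ hp₀r a)).2
    have h2 : ‖p - p₀‖ ≤ 1 := by
      rw [← dist_eq_norm]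
      exact (Metric.mem_ball.1 hp).le.trans ((min_le_right _ _).trans (min_le_left _ _))
    have h3 : B p₀ a a ≤ ‖B p₀‖ * ‖a‖ ^ 2 := by
      refine (le_abs_self _).trans ?_
      rw [← Real.norm_eq_abs]
      exact (ContinuousLinearMap.le_opNorm₂ _ _ _).trans_eq (by ring)
    have h4 : K₀ * ‖p - p₀‖ * ‖a‖ ^ 2 ≤ K₀ * 1 * ‖a‖ ^ 2 := by gcongr
    nlinarith [sq_nonneg ‖a‖]
  · have h1 := (abs_le.1 (hdiff p hp q hq a)).2
    have h4 : 0 ≤ (‖B p₀‖ + 1) * (‖p - q‖ * ‖a‖ ^ 2) := by positivity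
    nlinarith

end IsCoordMetric

/-- `ρ` is, near each point of `U`, the length distance of the metric `B`. -/
structure IsLocalLengthDist (U : Set E) (B : E → E →L[ℝ] E →L[ℝ] ℝ) (ρ : E → E → ℝ) : Prop where
  le_length : ∀ (c c' : ℝ → E) (a b : ℝ), a ≤ b → IsC1Curve c c' a b → (∀ t ∈ Icc a b, c t ∈ U) →
    ρ (c a) (c b) ≤ ∫ t in a..b, formNorm (B (c t)) (c' t)
  exists_curve : ∀ p₀ ∈ U, ∀ V ∈ 𝓝 p₀, ∃ V' ∈ 𝓝 p₀, ∀ p ∈ V', ∀ q ∈ V', ∀ L, ρ p q < L →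
    ∃ c c' : ℝ → E, IsC1Curve c c' 0 1 ∧ c 0 = p ∧ c 1 = q ∧ (∀ t ∈ Icc (0 : ℝ) 1, c t ∈ V) ∧
      ∫ t in (0 : ℝ)..1, formNorm (B (c t)) (c' t) ≤ L

theorem continuousOn_formNorm {U : Set E} {B : E → E →L[ℝ] E →L[ℝ] ℝ} (hB : ContinuousOn B U)
    {c c' : ℝ → E} {s : Set ℝ} (hc : ContinuousOn c s) (hc' : ContinuousOn c' s)
    (hU : ∀ t ∈ s, c t ∈ U) : ContinuousOn (fun t => formNorm (B (c t)) (c' t)) s :=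
  (((hB.comp hc hU).clm_apply hc').clm_apply hc').sqrt

end Coordinates

/-! ### Comparison of the distance with the metric frozen at a point. -/

section Coordinates

open MeasureTheory intervalIntegral

variable {E : Type*} [NormedAddCommGroup E] [NormedSpace ℝ E]
variable {U : Set E} {B : E → E →L[ℝ] E →L[ℝ] ℝ} {ρ : E → E → ℝ}

theorem isC1Curve_segment (p w : E) (a b : ℝ) :
    IsC1Curve (fun t => p + t • w) (fun _ => w) a b := by
  refine ⟨fun t _ => ?_, continuousOn_const⟩
  have := ((hasDerivAt_id t).smul_const w).const_add p
  simpa using this.hasDerivWithinAt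

theorem formNorm_sq {b : E →L[ℝ] E →L[ℝ] ℝ} {a : E} (h : 0 ≤ b a a) :
    formNorm b a ^ 2 = b a a := Real.sq_sqrt h

theorem formNorm_nonneg (b : E →L[ℝ] E →L[ℝ] ℝ) (a : E) : 0 ≤ formNorm b a := Real.sqrt_nonneg _

/-- The distance is at most the length of a segment. -/
theorem IsLocalLengthDist.le_of_segment (hB : IsCoordMetric U B) (hρ : IsLocalLengthDist U B ρ)
    {p q : E} {A : ℝ}
    (hU : ∀ t ∈ Icc (0 : ℝ) 1, p + t • (q - p) ∈ U)
    (hA : ∀ t ∈ Icc (0 : ℝ) 1, B (p + t • (q - p)) (q - p) (q - p) ≤ A) :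
    ρ p q ≤ Real.sqrt A := by
  have hc := isC1Curve_segment p (q - p) 0 1
  have h := hρ.le_length _ _ 0 1 zero_le_one hc hU
  simp only [zero_smul, add_zero, one_smul, add_sub_cancel] at h
  refine h.trans ?_
  calc ∫ t in (0 : ℝ)..1, formNorm (B (p + t • (q - p))) (q - p)
      ≤ ∫ _ in (0 : ℝ)..1, Real.sqrt A := by
        refine integral_mono_on zero_le_one ?_ (by simp) fun t ht => Real.sqrt_le_sqrt (hA t ht)
        exact (continuousOn_formNorm hB.contDiffOn.continuousOn hc.continuousOn
          hc.continuousOn_deriv hU).intervalIntegrable_of_Icc zero_le_one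
    _ = Real.sqrt A := by simp

/-- A lower bound for the length of a curve in terms of the frozen metric at `z`. -/
theorem IsCoordMetric.le_length_of_bounds [CompleteSpace E] (hB : IsCoordMetric U B) {V : Set E}
    (hV : V ⊆ U) {m K : ℝ} (hm : 0 < m) (hK : 0 < K)
    (hlow : ∀ p ∈ V, ∀ a, m * ‖a‖ ^ 2 ≤ B p a a)
    (hLip : ∀ p ∈ V, ∀ q ∈ V, ∀ a, B p a a ≤ B q a a + K * ‖p - q‖ * ‖a‖ ^ 2)
    {z : E} (hz : z ∈ V) {c c' : ℝ → E} (hc : IsC1Curve c c' 0 1)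
    (hcV : ∀ t ∈ Icc (0 : ℝ) 1, c t ∈ V) {L : ℝ}
    (hL : ∫ t in (0 : ℝ)..1, formNorm (B (c t)) (c' t) ≤ L) :
    ‖c 1 - c 0‖ ≤ L / Real.sqrt m ∧
    (1 - K / m * (‖c 0 - z‖ + L / Real.sqrt m)) * B z (c 1 - c 0) (c 1 - c 0) ≤ L ^ 2 := by
  have hBc : ContinuousOn B U := hB.contDiffOn.continuousOn
  have hsm : 0 < Real.sqrt m := Real.sqrt_pos.2 hm
  have hfc : ContinuousOn (fun t => formNorm (B (c t)) (c' t)) (Icc 0 1) :=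
    continuousOn_formNorm hBc hc.continuousOn hc.continuousOn_deriv fun t ht => hV (hcV t ht)
  have hfi : IntervalIntegrable (fun t => formNorm (B (c t)) (c' t)) volume 0 1 :=
    hfc.intervalIntegrable_of_Icc zero_le_one
  have hnorm : ∀ t ∈ Icc (0 : ℝ) 1, ‖c' t‖ ≤ formNorm (B (c t)) (c' t) / Real.sqrt m := by
    intro t ht
    rw [le_div_iff₀ hsm, formNorm]
    refine Real.le_sqrt_of_sq_le ?_
    rw [mul_pow, Real.sq_sqrt hm.le, mul_comm]
    exact hlow _ (hcV t ht) _
  have hL0 : 0 ≤ L := (integral_nonneg zero_le_one fun t _ => formNorm_nonneg _ _).trans hL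
  -- By ellipticity a curve of length at most L stays within L/√m of its start, which bounds the
  -- variation of the metric along it.
  have hmove : ∀ t ∈ Icc (0 : ℝ) 1, ‖c t - c 0‖ ≤ L / Real.sqrt m := by
    intro t ht
    have hct := hc.mono le_rfl ht.2
    rw [← hct.integral_eq ht.1]
    have hit : IntervalIntegrable (fun t => formNorm (B (c t)) (c' t)) volume 0 t :=
      (hfc.mono (Icc_subset_Icc le_rfl ht.2)).intervalIntegrable_of_Icc ht.1
    calc ‖∫ s in (0 : ℝ)..t, c' s‖ ≤ ∫ s in (0 : ℝ)..t, ‖c' s‖ := norm_integral_le_integral_norm ht.1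
      _ ≤ ∫ s in (0 : ℝ)..t, formNorm (B (c s)) (c' s) / Real.sqrt m := by
        refine integral_mono_on ht.1 ?_ (hit.div_const _)
          fun s hs => hnorm s ⟨hs.1, hs.2.trans ht.2⟩
        exact hct.continuousOn_deriv.norm.intervalIntegrable_of_Icc ht.1
      _ = (∫ s in (0 : ℝ)..t, formNorm (B (c s)) (c' s)) / Real.sqrt m := by
        rw [intervalIntegral.integral_div]
      _ ≤ L / Real.sqrt m := by
        gcongr
        refine le_trans ?_ hL
        exact integral_mono_interval le_rfl ht.1 ht.2
          (Eventually.of_forall fun s => formNorm_nonneg _ _) hfi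
  refine ⟨hmove 1 ⟨zero_le_one, le_rfl⟩, ?_⟩
  -- On the velocities κ·B z ≤ B (c t), so lengths drop by a factor of at most √κ when the metric is
  -- frozen. For κ ≤ 0 the claim is trivial.
  set κ := 1 - K / m * (‖c 0 - z‖ + L / Real.sqrt m) with hκ
  set w := c 1 - c 0 with hw
  have hzU := hV hz
  rcases le_or_gt κ 0 with hκ0 | hκ0
  · exact (mul_nonpos_of_nonpos_of_nonneg hκ0 (hB.nonneg hzU w)).trans (sq_nonneg L)
  have hpt : ∀ t ∈ Icc (0 : ℝ) 1,
      Real.sqrt κ * formNorm (B z) (c' t) ≤ formNorm (B (c t)) (c' t) := by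
    intro t ht
    rw [formNorm, formNorm, ← Real.sqrt_mul hκ0.le]
    refine Real.sqrt_le_sqrt ?_
    have h1 := hLip z hz (c t) (hcV t ht) (c' t)
    have h2 := hlow z hz (c' t)
    have h3 : ‖z - c t‖ ≤ ‖c 0 - z‖ + L / Real.sqrt m := by
      rw [norm_sub_rev]
      calc ‖c t - z‖ = ‖(c 0 - z) + (c t - c 0)‖ := by congr 1; abel
        _ ≤ _ := (norm_add_le _ _).trans (by gcongr; exact hmove t ht)
    have h4 : K * ‖z - c t‖ * ‖c' t‖ ^ 2
        ≤ K / m * (‖c 0 - z‖ + L / Real.sqrt m) * B z (c' t) (c' t) := by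
      calc K * ‖z - c t‖ * ‖c' t‖ ^ 2 = K / m * ‖z - c t‖ * (m * ‖c' t‖ ^ 2) := by field_simp
        _ ≤ K / m * (‖c 0 - z‖ + L / Real.sqrt m) * B z (c' t) (c' t) := by
          gcongr
    rw [hκ]; linarith
  have hgc : ContinuousOn (fun t => formNorm (B z) (c' t)) (Icc 0 1) :=
    ((continuousOn_const.clm_apply hc.continuousOn_deriv).clm_apply hc.continuousOn_deriv).sqrt
  have hgi : IntervalIntegrable (fun t => formNorm (B z) (c' t)) volume 0 1 :=
    hgc.intervalIntegrable_of_Icc zero_le_one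
  have hI1 : Real.sqrt κ * ∫ t in (0 : ℝ)..1, formNorm (B z) (c' t) ≤ L := by
    rw [← intervalIntegral.integral_const_mul]
    exact (integral_mono_on zero_le_one (hgi.const_mul _) hfi hpt).trans hL
  -- For a constant metric the chord is shortest: integrate B z w (c' t) and apply Cauchy-Schwarz.
  have hI2 : formNorm (B z) w ≤ ∫ t in (0 : ℝ)..1, formNorm (B z) (c' t) := by
    rcases (formNorm_nonneg (B z) w).eq_or_lt with h0 | h0
    · rw [← h0]; exact integral_nonneg zero_le_one fun t _ => formNorm_nonneg _ _
    have hi : ∫ t in (0 : ℝ)..1, B z w (c' t) = B z w w := by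
      rw [(B z w).intervalIntegral_comp_comm
        (hc.continuousOn_deriv.intervalIntegrable_of_Icc zero_le_one), hc.integral_eq zero_le_one]
    have : formNorm (B z) w * formNorm (B z) w
        ≤ formNorm (B z) w * ∫ t in (0 : ℝ)..1, formNorm (B z) (c' t) := by
      rw [← pow_two, formNorm_sq (hB.nonneg hzU w), ← hi,
        ← intervalIntegral.integral_const_mul]
      refine integral_mono_on zero_le_one ?_ (hgi.const_mul _)
        fun t _ => hB.le_formNorm_mul hzU _ _
      exact ((B z w).continuous.comp_continuousOn
        hc.continuousOn_deriv).intervalIntegrable_of_Icc zero_le_one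
    exact le_of_mul_le_mul_left this h0
  have hfin : Real.sqrt κ * formNorm (B z) w ≤ L :=
    (mul_le_mul_of_nonneg_left hI2 (Real.sqrt_nonneg _)).trans hI1
  have := pow_le_pow_left₀ (mul_nonneg (Real.sqrt_nonneg _) (formNorm_nonneg _ _)) hfin 2
  rwa [mul_pow, Real.sq_sqrt hκ0.le, formNorm_sq (hB.nonneg hzU w)] at this

/-- Near a point, the distance is given by the metric frozen at a point `z`, up to an error
which is of first order relative to the main term. -/
theorem IsLocalLengthDist.exists_estimate [FiniteDimensional ℝ E] (hB : IsCoordMetric U B)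
    (hρ : IsLocalLengthDist U B ρ) (hρ0 : ∀ p q, 0 ≤ ρ p q) {p₀ : E} (hp₀ : p₀ ∈ U) :
    ∃ r > 0, ∃ C > 0, Metric.ball p₀ r ⊆ U ∧
      (∀ p ∈ Metric.ball p₀ r, ∀ q ∈ Metric.ball p₀ r, ‖q - p‖ ≤ C * ρ p q) ∧
      (∀ p ∈ Metric.ball p₀ r, ∀ a, ‖a‖ ^ 2 ≤ C * B p a a) ∧
      ∀ z ∈ Metric.ball p₀ r, ∀ p ∈ Metric.ball p₀ r, ∀ q ∈ Metric.ball p₀ r,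
        |ρ p q ^ 2 - B z (q - p) (q - p)| ≤ C * (‖p - z‖ + ‖q - z‖) * ‖q - p‖ ^ 2 := by
  have : CompleteSpace E := FiniteDimensional.complete ℝ E
  obtain ⟨r₁, hr₁, m, hm, K, hK, hsub, hlow, hup, hLip⟩ := hB.exists_bounds hp₀
  obtain ⟨V', hV', hcur⟩ := hρ.exists_curve p₀ hp₀ _ (Metric.ball_mem_nhds p₀ hr₁)
  obtain ⟨r₂, hr₂, hr₂V⟩ := Metric.mem_nhds_iff.1 hV'
  have hsm : 0 < Real.sqrt m := Real.sqrt_pos.2 hm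
  set r := min r₁ r₂
  have hb1 : Metric.ball p₀ r ⊆ Metric.ball p₀ r₁ := Metric.ball_subset_ball (min_le_left _ _)
  have hb2 : Metric.ball p₀ r ⊆ V' := (Metric.ball_subset_ball (min_le_right _ _)).trans hr₂V
  set k₁ := K / m * (1 + Real.sqrt K / Real.sqrt m) * K with hk₁
  have hk₁0 : 0 < k₁ := by positivity
  have hseg : ∀ p ∈ Metric.ball p₀ r₁, ∀ q ∈ Metric.ball p₀ r₁, ∀ t ∈ Icc (0 : ℝ) 1,
      p + t • (q - p) ∈ Metric.ball p₀ r₁ := by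
    intro p hp q hq t ht
    exact (convex_ball p₀ r₁).add_smul_sub_mem hp hq ht
  have hlower : ∀ p ∈ Metric.ball p₀ r, ∀ q ∈ Metric.ball p₀ r, ∀ z ∈ Metric.ball p₀ r,
      ‖q - p‖ ≤ ρ p q / Real.sqrt m ∧
      (1 - K / m * (‖p - z‖ + ρ p q / Real.sqrt m)) * B z (q - p) (q - p) ≤ ρ p q ^ 2 := by
    intro p hp q hq z hz
    -- The distance need not be attained by a curve, so the bounds are proved for every L > ρ p q
    -- and passed to the limit.
    have hL : ∀ L, ρ p q < L → ‖q - p‖ ≤ L / Real.sqrt m ∧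
        (1 - K / m * (‖p - z‖ + L / Real.sqrt m)) * B z (q - p) (q - p) ≤ L ^ 2 := by
      intro L hL
      obtain ⟨c, c', hc, h0, h1, hcV, hlen⟩ := hcur p (hb2 hp) q (hb2 hq) L hL
      have := hB.le_length_of_bounds hsub hm hK hlow hLip (hb1 hz) hc hcV hlen
      rwa [h0, h1] at this
    constructor
    · have hlim : Tendsto (fun L => L / Real.sqrt m) (𝓝[>] (ρ p q)) (𝓝 (ρ p q / Real.sqrt m)) :=
        (Continuous.tendsto (by fun_prop) _).mono_left nhdsWithin_le_nhds
      refine ge_of_tendsto hlim ?_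
      filter_upwards [self_mem_nhdsWithin] with L h using (hL L h).1
    · refine le_of_tendsto_of_tendsto (b := 𝓝[>] (ρ p q))
        (f := fun L => (1 - K / m * (‖p - z‖ + L / Real.sqrt m)) * B z (q - p) (q - p))
        (g := fun L => L ^ 2) ?_ ?_ ?_
      · exact (Continuous.tendsto (by fun_prop) _).mono_left nhdsWithin_le_nhds
      · exact (Continuous.tendsto (by fun_prop) _).mono_left nhdsWithin_le_nhds
      · filter_upwards [self_mem_nhdsWithin] with L h using (hL L h).2
  -- One constant for all claims: K and k₁ are the upper and lower errors of the squared distance,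
  -- 1/√m and 1/m the comparisons with the norm.
  refine ⟨r, lt_min hr₁ hr₂, K + k₁ + 1 / Real.sqrt m + 1 / m, by positivity, hb1.trans hsub,
    fun p hp q hq => ?_, fun p hp a => ?_, fun z hz p hp q hq => ?_⟩
  · have h1 := (hlower p hp q hq p hp).1
    have h2 : 0 ≤ (K + k₁ + 1 / m) * ρ p q := mul_nonneg (by positivity) (hρ0 p q)
    calc _ ≤ _ := h1
      _ = 1 / Real.sqrt m * ρ p q := by ring
      _ ≤ _ := by linarith
  · have h1 := hlow p (hb1 hp) a
    have h2 : 0 ≤ B p a a := hB.nonneg (hsub (hb1 hp)) a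
    calc ‖a‖ ^ 2 = 1 / m * (m * ‖a‖ ^ 2) := by field_simp
      _ ≤ 1 / m * B p a a := by gcongr
      _ ≤ _ := by gcongr; linarith [show 0 < K + k₁ + 1 / Real.sqrt m by positivity]
  · set w := q - p
    set σ := ‖p - z‖ + ‖q - z‖ with hσ
    have hσ0 : 0 ≤ σ := by positivity
    have hw : ‖w‖ ≤ σ := by
      calc ‖w‖ = ‖(q - z) - (p - z)‖ := by congr 1; simp [w]
        _ ≤ σ := (norm_sub_le _ _).trans_eq (add_comm _ _)
    have hA0 : 0 ≤ B z w w + K * σ * ‖w‖ ^ 2 :=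
      add_nonneg (hB.nonneg (hsub (hb1 hz)) w) (by positivity)
    have hup1 : ρ p q ≤ Real.sqrt (B z w w + K * σ * ‖w‖ ^ 2) := by
      refine hρ.le_of_segment hB (fun t ht => hsub (hseg p (hb1 hp) q (hb1 hq) t ht)) fun t ht => ?_
      refine (hLip _ (hseg p (hb1 hp) q (hb1 hq) t ht) z (hb1 hz) _).trans ?_
      gcongr
      calc ‖p + t • (q - p) - z‖ = ‖(1 - t) • (p - z) + t • (q - z)‖ := by
            congr 1; module
        _ ≤ ‖(1 - t) • (p - z)‖ + ‖t • (q - z)‖ := norm_add_le _ _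
        _ = (1 - t) * ‖p - z‖ + t * ‖q - z‖ := by
            rw [norm_smul, norm_smul, Real.norm_of_nonneg ht.1,
              Real.norm_of_nonneg (by linarith [ht.2])]
        _ ≤ σ := by nlinarith [norm_nonneg (p - z), norm_nonneg (q - z), ht.1, ht.2]
    have hup2 : ρ p q ≤ Real.sqrt K * σ := by
      have : ρ p q ≤ Real.sqrt (K * ‖w‖ ^ 2) :=
        hρ.le_of_segment hB (fun t ht => hsub (hseg p (hb1 hp) q (hb1 hq) t ht))
          fun t ht => hup _ (hseg p (hb1 hp) q (hb1 hq) t ht) _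
      rw [Real.sqrt_mul hK.le, Real.sqrt_sq (norm_nonneg _)] at this
      exact this.trans (by gcongr)
    have hsq : ρ p q ^ 2 ≤ B z w w + K * σ * ‖w‖ ^ 2 := by
      have := pow_le_pow_left₀ (hρ0 p q) hup1 2
      rwa [Real.sq_sqrt hA0] at this
    have hlo := (hlower p hp q hq z hz).2
    have hlo2 : K / m * (‖p - z‖ + ρ p q / Real.sqrt m) * B z w w ≤ k₁ * σ * ‖w‖ ^ 2 := by
      calc K / m * (‖p - z‖ + ρ p q / Real.sqrt m) * B z w w
          ≤ K / m * (σ + Real.sqrt K * σ / Real.sqrt m) * (K * ‖w‖ ^ 2) := by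
            gcongr
            · exact hB.nonneg (hsub (hb1 hz)) w
            · rw [hσ]; linarith [norm_nonneg (q - z)]
            · exact hup z (hb1 hz) w
        _ = k₁ * σ * ‖w‖ ^ 2 := by rw [hk₁]; ring
    have hrest : 0 ≤ (1 / Real.sqrt m + 1 / m) * (σ * ‖w‖ ^ 2) := by positivity
    have hr1 : 0 ≤ K * (σ * ‖w‖ ^ 2) := by positivity
    have hr2 : 0 ≤ k₁ * (σ * ‖w‖ ^ 2) := by positivity
    rw [abs_le]
    constructor <;> linarith

end Coordinates

/-! ### C¹ regularity of curves that are isometric up to scaling. -/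

section Coordinates

open MeasureTheory intervalIntegral

variable {E : Type*} [NormedAddCommGroup E] [NormedSpace ℝ E]
variable {U : Set E} {B : E → E →L[ℝ] E →L[ℝ] ℝ} {ρ : E → E → ℝ}

/-- A curve whose second differences at scale `h` are `O(h ^ (3/2))` is of class `C¹`. -/
theorem exists_continuousOn_deriv_of_second_difference [CompleteSpace E] {u : ℝ → E} {t₀ δ C : ℝ}
    (hδ : 0 < δ) (hC : 0 ≤ C) (hu : ContinuousOn u (Ioo (t₀ - 2 * δ) (t₀ + 2 * δ)))
    (h2 : ∀ s ∈ Ioo (t₀ - 2 * δ) (t₀ + 2 * δ), ∀ t ∈ Ioo (t₀ - 2 * δ) (t₀ + 2 * δ), s ≤ t →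
      ‖u s + u t - (2 : ℝ) • u ((s + t) / 2)‖ ^ 2 ≤ C * (t - s) ^ 3) :
    ∃ v : ℝ → E, ContinuousOn v (Ioo (t₀ - δ) (t₀ + δ)) ∧
      ∀ t ∈ Ioo (t₀ - δ) (t₀ + δ), HasDerivAt u (v t) t := by
  set J := Ioo (t₀ - δ) (t₀ + δ) with hJ
  set J₂ := Ioo (t₀ - 2 * δ) (t₀ + 2 * δ) with hJ₂
  set h : ℕ → ℝ := fun n => δ / 2 ^ n with hh
  have hh0 : ∀ n, 0 < h n := fun n => by positivity
  have hhδ : ∀ n, h n ≤ δ := fun n => div_le_self hδ.le (one_le_pow₀ one_le_two)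
  have hhs : ∀ n, h (n + 1) = h n / 2 := fun n => by simp only [hh, pow_succ]; field_simp
  have hJJ : ∀ t ∈ J, t ∈ J₂ := fun t ht => ⟨by linarith [ht.1], by linarith [ht.2]⟩
  have hJh : ∀ n, ∀ t ∈ J, t + h n ∈ J₂ := fun n t ht =>
    ⟨by linarith [ht.1, hh0 n], by linarith [ht.2, hhδ n]⟩
  have hhlim : Tendsto h atTop (𝓝 0) := by
    have := (tendsto_pow_atTop_nhds_zero_of_lt_one (r := (1 / 2 : ℝ)) (by norm_num)
      (by norm_num)).const_mul δ
    rw [mul_zero] at this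
    refine this.congr fun n => ?_
    simp only [hh, one_div, inv_pow]; rfl
  set F : ℕ → ℝ → E := fun n t => (h n)⁻¹ • (u (t + h n) - u t) with hF
  set q := Real.sqrt (1 / 2) with hq
  have hq0 : 0 ≤ q := Real.sqrt_nonneg _
  have hq1 : q < 1 := by
    rw [hq, Real.sqrt_lt' one_pos]; norm_num
  -- Halving the step changes the difference quotient by a second difference divided by h, of size
  -- √(C h); along dyadic steps this is a geometric series of ratio √(1/2).
  have hFd : ∀ t ∈ J, ∀ n, dist (F n t) (F (n + 1) t) ≤ Real.sqrt (C * δ) * q ^ n := by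
    intro t ht n
    rw [dist_eq_norm]
    have e1 : F n t - F (n + 1) t
        = (h n)⁻¹ • (u t + u (t + h n) - (2 : ℝ) • u ((t + (t + h n)) / 2)) := by
      simp only [hF]
      rw [hhs, show (t + (t + h n)) / 2 = t + h n / 2 by ring,
        show (h n / 2)⁻¹ = (h n)⁻¹ * 2 by rw [inv_div]; ring]
      module
    rw [e1, norm_smul, Real.norm_of_nonneg (inv_nonneg.2 (hh0 n).le)]
    refine abs_le_of_sq_le_sq' ?_ (by positivity) |>.2
    rw [mul_pow, mul_pow, Real.sq_sqrt (by positivity), ← pow_mul, mul_comm n 2, pow_mul, hq,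
      Real.sq_sqrt (by norm_num)]
    have := h2 t (hJJ t ht) (t + h n) (hJh n t ht) (by linarith [hh0 n])
    rw [add_sub_cancel_left] at this
    calc _ ≤ (h n)⁻¹ ^ 2 * (C * h n ^ 3) := by gcongr
      _ = C * h n := by have := (hh0 n).ne'; field_simp
      _ = _ := by simp only [hh, one_div, inv_pow]; ring
  have hconv : ∀ t, ∃ w, t ∈ J → Tendsto (fun n => F n t) atTop (𝓝 w) := by
    intro t
    by_cases ht : t ∈ J
    · obtain ⟨w, hw⟩ := cauchySeq_tendsto_of_complete
        (cauchySeq_of_le_geometric q _ hq1 (hFd t ht))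
      exact ⟨w, fun _ => hw⟩
    · exact ⟨0, fun h => absurd h ht⟩
  choose v hv using hconv
  have hunif : TendstoUniformlyOn F v atTop J := by
    rw [Metric.tendstoUniformlyOn_iff]
    intro ε hε
    have hlim : Tendsto (fun n => Real.sqrt (C * δ) * q ^ n / (1 - q)) atTop (𝓝 0) := by
      have := ((tendsto_pow_atTop_nhds_zero_of_lt_one hq0 hq1).const_mul
        (Real.sqrt (C * δ))).div_const (1 - q)
      simpa using this
    filter_upwards [hlim.eventually_lt_const hε] with n hn t ht
    rw [dist_comm]
    exact (dist_le_of_le_geometric_of_tendsto q _ hq1 (hFd t ht) (hv t ht) n).trans_lt hn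
  have hFc : ∀ n, ContinuousOn (F n) J := by
    intro n
    refine ContinuousOn.const_smul (ContinuousOn.sub ?_ (hu.mono hJJ)) _
    exact hu.comp (by fun_prop) (hJh n)
  have ht₀ : t₀ ∈ J₂ := ⟨by linarith, by linarith⟩
  -- The quotients of u converge only along dyadic steps. They are, however, derivatives of the
  -- quotients of the antiderivative G, which tend to u, so uniform convergence of derivatives
  -- yields u' = v.
  set G : ℝ → E := fun t => ∫ s in t₀..t, u s with hG
  have hGd : ∀ t ∈ J₂, HasDerivAt G (u t) t := by
    intro t ht
    have hsub : uIcc t₀ t ⊆ J₂ := (ordConnected_Ioo).uIcc_subset ht₀ ht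
    exact integral_hasDerivAt_right ((hu.mono hsub).intervalIntegrable)
      (hu.stronglyMeasurableAtFilter isOpen_Ioo t ht) (hu.continuousAt (isOpen_Ioo.mem_nhds ht))
  refine ⟨v, hunif.continuousOn (Frequently.of_forall hFc), fun t ht => ?_⟩
  refine hasDerivAt_of_tendstoUniformlyOn (f := fun n t => (h n)⁻¹ • (G (t + h n) - G t))
    isOpen_Ioo hunif (Eventually.of_forall fun n s hs => ?_) (fun s hs => ?_) ht
  · exact (((hGd _ (hJh n s hs)).comp_add_const s (h n)).sub (hGd s (hJJ s hs))).const_smul _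
  · have h1 := hasDerivAt_iff_tendsto_slope_zero.1 (hGd s (hJJ s hs))
    exact h1.comp (tendsto_nhdsWithin_iff.2 ⟨hhlim, Eventually.of_forall fun n => (hh0 n).ne'⟩)

/-- A curve that is isometric up to scaling for a Riemannian distance is `C¹`, with constant
speed. -/
theorem IsLocalLengthDist.exists_velocity [FiniteDimensional ℝ E] (hB : IsCoordMetric U B)
    (hρ : IsLocalLengthDist U B ρ) (hρ0 : ∀ p q, 0 ≤ ρ p q) {u : ℝ → E} {t₀ η D : ℝ} (hη : 0 < η)
    (hD : 0 ≤ D) (hu : ContinuousOn u (Ioo (t₀ - η) (t₀ + η))) (hu₀ : u t₀ ∈ U)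
    (hud : ∀ s ∈ Ioo (t₀ - η) (t₀ + η), ∀ t ∈ Ioo (t₀ - η) (t₀ + η),
      ρ (u s) (u t) = |s - t| * D) :
    ∃ δ > 0, δ ≤ η ∧ ∃ v : ℝ → E, ContinuousOn v (Ioo (t₀ - δ) (t₀ + δ)) ∧
      ∀ t ∈ Ioo (t₀ - δ) (t₀ + δ), u t ∈ U ∧ HasDerivAt u (v t) t ∧
        B (u t) (v t) (v t) = D ^ 2 := by
  have : CompleteSpace E := FiniteDimensional.complete ℝ E
  obtain ⟨r, hr, C, hC, hrU, hnorm, hell, hest⟩ := hρ.exists_estimate hB hρ0 hu₀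
  have ht₀ : t₀ ∈ Ioo (t₀ - η) (t₀ + η) := ⟨by linarith, by linarith⟩
  have hnhd : u ⁻¹' Metric.ball (u t₀) r ∈ 𝓝 t₀ :=
    (hu.continuousAt (Ioo_mem_nhds ht₀.1 ht₀.2)).preimage_mem_nhds (Metric.ball_mem_nhds _ hr)
  obtain ⟨δ', hδ', hball⟩ := Metric.mem_nhds_iff.1 hnhd
  set δ := min (η / 2) (δ' / 2) with hδdef
  have hδ : 0 < δ := by positivity
  have hδη : 2 * δ ≤ η := by linarith [min_le_left (η / 2) (δ' / 2)]
  have hδδ : 2 * δ ≤ δ' := by linarith [min_le_right (η / 2) (δ' / 2)]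
  set J₂ := Ioo (t₀ - 2 * δ) (t₀ + 2 * δ) with hJ₂
  have hJη : J₂ ⊆ Ioo (t₀ - η) (t₀ + η) := Ioo_subset_Ioo (by linarith) (by linarith)
  have hJb : ∀ t ∈ J₂, u t ∈ Metric.ball (u t₀) r := by
    intro t ht
    refine hball ?_
    rw [Metric.mem_ball, Real.dist_eq, abs_lt]
    constructor <;> linarith [ht.1, ht.2]
  have hLip : ∀ s ∈ J₂, ∀ t ∈ J₂, ‖u t - u s‖ ≤ C * D * |t - s| := by
    intro s hs t ht
    have := hnorm _ (hJb s hs) _ (hJb t ht)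
    rw [hud s (hJη hs) t (hJη ht), abs_sub_comm] at this
    linarith
  -- Parallelogram identity for the metric frozen at the midpoint: up to third-order errors the
  -- squared distances are h²D², h²D² and 4h²D², and 2 + 2 - 4 = 0 cancels the second order.
  have hsecond : ∀ s ∈ J₂, ∀ t ∈ J₂, s ≤ t →
      ‖u s + u t - (2 : ℝ) • u ((s + t) / 2)‖ ^ 2 ≤ C * (2 * C * (C * D) ^ 3) * (t - s) ^ 3 := by
    intro s hs t ht hst
    set k := (s + t) / 2 with hk
    have hkm : k ∈ J₂ := ⟨by linarith [hs.1, ht.1], by linarith [hs.2, ht.2]⟩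
    set h := (t - s) / 2 with hh
    have hh0 : 0 ≤ h := by linarith
    set M := C * D with hM
    have hM0 : 0 ≤ M := by positivity
    have n1 : ‖u k - u s‖ ≤ M * h := by
      have := hLip s hs k hkm
      rwa [show k - s = h by rw [hk, hh]; ring, abs_of_nonneg hh0] at this
    have n2 : ‖u t - u k‖ ≤ M * h := by
      have := hLip k hkm t ht
      rwa [show t - k = h by rw [hk, hh]; ring, abs_of_nonneg hh0] at this
    have n3 : ‖u t - u s‖ ≤ 2 * (M * h) := by
      calc ‖u t - u s‖ = ‖(u t - u k) + (u k - u s)‖ := by congr 1; abel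
        _ ≤ _ := (norm_add_le _ _).trans (by linarith)
    have q1 := hest _ (hJb k hkm) _ (hJb s hs) _ (hJb k hkm)
    have q2 := hest _ (hJb k hkm) _ (hJb k hkm) _ (hJb t ht)
    have q3 := hest _ (hJb k hkm) _ (hJb s hs) _ (hJb t ht)
    rw [hud s (hJη hs) k (hJη hkm), abs_sub_comm s k, show k - s = h by rw [hk, hh]; ring,
      abs_of_nonneg hh0, sub_self, norm_zero, add_zero, norm_sub_rev (u s)] at q1
    rw [hud k (hJη hkm) t (hJη ht), abs_sub_comm k t, show t - k = h by rw [hk, hh]; ring,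
      abs_of_nonneg hh0, sub_self, norm_zero, zero_add] at q2
    rw [hud s (hJη hs) t (hJη ht), abs_sub_comm s t, show t - s = 2 * h by rw [hh]; ring,
      abs_of_nonneg (show (0 : ℝ) ≤ 2 * h by positivity), norm_sub_rev (u s)] at q3
    have b1 : C * ‖u k - u s‖ * ‖u k - u s‖ ^ 2 ≤ C * (M * h) * (M * h) ^ 2 := by gcongr
    have b2 : C * ‖u t - u k‖ * ‖u t - u k‖ ^ 2 ≤ C * (M * h) * (M * h) ^ 2 := by gcongr
    have b3 : C * (‖u k - u s‖ + ‖u t - u k‖) * ‖u t - u s‖ ^ 2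
        ≤ C * (M * h + M * h) * (2 * (M * h)) ^ 2 := by gcongr
    have par : ∀ x y : E, B (u k) (y - x) (y - x) + B (u k) (x + y) (x + y)
        = 2 * B (u k) x x + 2 * B (u k) y y := by
      intro x y
      simp only [map_add, map_sub, add_apply, sub_apply]
      ring
    have hpar := par (u k - u s) (u t - u k)
    rw [show u t - u k - (u k - u s) = u s + u t - (2 : ℝ) • u k by module,
      show u k - u s + (u t - u k) = u t - u s by abel] at hpar
    have hB1 := (abs_le.1 q1).1
    have hB2 := (abs_le.1 q2).1
    have hB3 := (abs_le.1 q3).2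
    have e := hell _ (hJb k hkm) (u s + u t - (2 : ℝ) • u k)
    refine e.trans ?_
    have hts : t - s = 2 * h := by rw [hh]; ring
    rw [hts]
    have : B (u k) (u s + u t - (2 : ℝ) • u k) (u s + u t - (2 : ℝ) • u k)
        ≤ 2 * C * M ^ 3 * (2 * h) ^ 3 := by
      have : 0 ≤ C * (M * h) ^ 3 := by positivity
      linarith
    calc _ ≤ C * (2 * C * M ^ 3 * (2 * h) ^ 3) := by gcongr
      _ = _ := by ring
  obtain ⟨v, hvc, hv⟩ := exists_continuousOn_deriv_of_second_difference hδ
    (by positivity) (hu.mono hJη) hsecond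
  refine ⟨δ, hδ, by linarith, v, hvc, fun t ht => ?_⟩
  have htJ : t ∈ J₂ := ⟨by linarith [ht.1], by linarith [ht.2]⟩
  refine ⟨hrU (hJb t htJ), hv t ht, ?_⟩
  have hsl := hasDerivAt_iff_tendsto_slope_zero.1 (hv t ht)
  have lim1 : Tendsto (fun h : ℝ => B (u t) (h⁻¹ • (u (t + h) - u t)) (h⁻¹ • (u (t + h) - u t)))
      (𝓝[≠] 0) (𝓝 (B (u t) (v t) (v t))) :=
    (((B (u t)).continuous.clm_apply continuous_id).tendsto (v t)).comp hsl
  refine tendsto_nhds_unique lim1 ?_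
  rw [tendsto_iff_norm_sub_tendsto_zero]
  -- The estimate with the metric frozen at u t, divided by h², compares the squared norm of the
  -- difference quotient with D².
  have hle : ∀ᶠ h : ℝ in 𝓝[≠] 0,
      ‖B (u t) (h⁻¹ • (u (t + h) - u t)) (h⁻¹ • (u (t + h) - u t)) - D ^ 2‖
        ≤ C * ‖h⁻¹ • (u (t + h) - u t)‖ ^ 2 * ‖u (t + h) - u t‖ := by
    have hev : ∀ᶠ h : ℝ in 𝓝 0, t + h ∈ J₂ := by
      have : Tendsto (fun h : ℝ => t + h) (𝓝 0) (𝓝 (t + 0)) := Continuous.tendsto (by fun_prop) _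
      rw [add_zero] at this
      exact this.eventually (isOpen_Ioo.mem_nhds htJ)
    filter_upwards [hev.filter_mono nhdsWithin_le_nhds, self_mem_nhdsWithin] with h hh hh0
    have hh0 : h ≠ 0 := hh0
    have q := hest _ (hJb t htJ) _ (hJb t htJ) _ (hJb _ hh)
    rw [hud t (hJη htJ) _ (hJη hh), sub_self, norm_zero, zero_add, sub_add_cancel_left, abs_neg,
      mul_pow, sq_abs] at q
    set w := u (t + h) - u t
    have e1 : B (u t) (h⁻¹ • w) (h⁻¹ • w) - D ^ 2 = (h ^ 2)⁻¹ * (B (u t) w w - h ^ 2 * D ^ 2) := by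
      simp only [map_smul, smul_apply, smul_eq_mul]
      field_simp
    rw [e1, norm_mul, Real.norm_of_nonneg (by positivity), Real.norm_eq_abs, abs_sub_comm,
      norm_smul, mul_pow, norm_inv, Real.norm_eq_abs, inv_pow, sq_abs]
    calc _ ≤ (h ^ 2)⁻¹ * (C * ‖w‖ * ‖w‖ ^ 2) := by gcongr
      _ = _ := by ring
  have lim2 : Tendsto (fun h : ℝ => C * ‖h⁻¹ • (u (t + h) - u t)‖ ^ 2 * ‖u (t + h) - u t‖)
      (𝓝[≠] 0) (𝓝 (C * ‖v t‖ ^ 2 * 0)) := by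
    refine (((hsl.norm).pow 2).const_mul C).mul ?_
    have hc : Tendsto (fun h : ℝ => u (t + h) - u t) (𝓝 0) (𝓝 0) := by
      have h1 : Tendsto (fun h : ℝ => t + h) (𝓝 0) (𝓝 t) := by
        simpa using (continuous_const_add t).tendsto (0 : ℝ)
      have := ((hv t ht).continuousAt.tendsto.comp h1).sub_const (u t)
      simpa using this
    simpa using (hc.mono_left nhdsWithin_le_nhds).norm
  rw [mul_zero] at lim2
  exact squeeze_zero' (Eventually.of_forall fun _ => norm_nonneg _) hle lim2

end Coordinates

/-! ### Linear equations and the first variation of energy. -/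

section Coordinates

open MeasureTheory intervalIntegral

variable {E : Type*} [NormedAddCommGroup E] [NormedSpace ℝ E]
variable {U : Set E} {B : E → E →L[ℝ] E →L[ℝ] ℝ} {ρ : E → E → ℝ}

/-- Solutions of linear differential equations exist on intervals of a length that depends only on
a bound for the coefficients. -/
theorem exists_linear_ode_solution [CompleteSpace E] {A : ℝ → E →L[ℝ] E} {a b K : ℝ} (hab : a ≤ b)
    (hA : ContinuousOn A (Icc a b)) (hK : ∀ t ∈ Icc a b, ‖A t‖ ≤ K) (hsmall : K * (b - a) ≤ 1 / 2)
    (w : E) : ∃ W : ℝ → E, W a = w ∧ IsC1Curve W (fun t => A t (W t)) a b := by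
  have hK0 : 0 ≤ K := (norm_nonneg _).trans (hK a ⟨le_rfl, hab⟩)
  -- On the ball of radius R about w one has ‖x‖ ≤ 2R, so the speed is at most 2KR and K(b - a) ≤
  -- 1/2 keeps the solution in the ball, whatever the size of w.
  set R : ℝ := ‖w‖ + 1 with hR
  have hpl : IsPicardLindelof (fun t x => A t x) (⟨a, le_rfl, hab⟩ : Icc a b) w
      (Real.toNNReal R) 0 (Real.toNNReal (2 * K * R)) (Real.toNNReal K) := by
    have hR0 : 0 ≤ R := by positivity
    refine ⟨fun t ht => ?_, fun x _ => hA.clm_apply continuousOn_const, fun t ht x hx => ?_, ?_⟩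
    · refine ((A t).lipschitz.weaken ?_).lipschitzOnWith
      rw [← Real.toNNReal_coe (r := ‖A t‖₊)]
      exact Real.toNNReal_le_toNNReal (hK t ht)
    · rw [Real.coe_toNNReal _ (by positivity)]
      rw [Metric.mem_closedBall, Real.coe_toNNReal _ hR0, dist_eq_norm] at hx
      have hx2 : ‖x‖ ≤ 2 * R := by
        calc ‖x‖ = ‖(x - w) + w‖ := by simp
          _ ≤ ‖x - w‖ + ‖w‖ := norm_add_le _ _
          _ ≤ 2 * R := by rw [hR] at hx ⊢; linarith
      calc ‖A t x‖ ≤ ‖A t‖ * ‖x‖ := (A t).le_opNorm x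
        _ ≤ K * (2 * R) := by gcongr; exact hK t ht
        _ = _ := by ring
    · rw [Real.coe_toNNReal _ (by positivity), Real.coe_toNNReal _ hR0]
      simp only [sub_self, NNReal.coe_zero, sub_zero]
      rw [max_eq_left (by linarith)]
      nlinarith
  obtain ⟨W, hW0, hW⟩ := hpl.exists_eq_forall_mem_Icc_hasDerivWithinAt₀
  refine ⟨W, hW0, hW, ?_⟩
  exact hA.clm_apply fun t ht => (hW t ht).continuousWithinAt

set_option maxSynthPendingDepth 3 in
/-- The energy density of the variation `u + ε Y` of a curve, and its derivative in `ε`. -/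
theorem IsCoordMetric.hasDerivAt_energy_density (hB : IsCoordMetric U B) {x y w z : E} {ε : ℝ}
    (hU : x + ε • y ∈ U) :
    HasDerivAt (fun e : ℝ => B (x + e • y) (w + e • z) (w + e • z))
      (fderiv ℝ B (x + ε • y) y (w + ε • z) (w + ε • z)
        + B (x + ε • y) z (w + ε • z) + B (x + ε • y) (w + ε • z) z) ε := by
  have line : ∀ p q : E, HasDerivAt (fun e : ℝ => p + e • q) q ε := fun p q => by
    simpa using ((hasDerivAt_id ε).smul_const q).const_add p
  have hBd : HasFDerivAt B (fderiv ℝ B (x + ε • y)) (x + ε • y) :=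
    ((hB.contDiffOn.contDiffAt (hB.isOpen.mem_nhds hU)).differentiableAt
      (by simp)).hasFDerivAt
  have h1 : HasDerivAt (fun e : ℝ => B (x + e • y)) (fderiv ℝ B (x + ε • y) y) ε :=
    hBd.comp_hasDerivAt ε (line x y)
  have h2 := (h1.clm_apply (line w z)).clm_apply (line w z)
  simpa only [add_apply] using h2

set_option maxSynthPendingDepth 3 in
set_option maxHeartbeats 1000000 in
/-- The first variation formula for a length-minimizing curve: the inner product of the velocity
with a parallel vector field is constant. -/
theorem IsLocalLengthDist.inner_velocity_parallel [CompleteSpace E] (hB : IsCoordMetric U B)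
    (hρ : IsLocalLengthDist U B ρ) {u v W W' : ℝ → E} {s t D : ℝ} (hst : s < t) (hD : 0 ≤ D)
    (hu : IsC1Curve u v s t) (hU : ∀ τ ∈ Icc s t, u τ ∈ U)
    (hspeed : ∀ τ ∈ Icc s t, B (u τ) (v τ) (v τ) = D ^ 2)
    (hdist : ρ (u s) (u t) = (t - s) * D) (hW : IsC1Curve W W' s t)
    (hpar : ∀ τ ∈ Icc s t, 2 * B (u τ) (W' τ) (v τ) + fderiv ℝ B (u τ) (W τ) (v τ) (v τ) = 0) :
    B (u s) (v s) (W s) = B (u t) (v t) (W t) := by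
  have hsI : s ∈ Icc s t := ⟨le_rfl, hst.le⟩
  have htI : t ∈ Icc s t := ⟨hst.le, le_rfl⟩
  -- For D = 0 the velocity vanishes; the comparison of length with energy below divides by D.
  rcases hD.eq_or_lt with h0 | hDpos
  · have hv0 : ∀ τ ∈ Icc s t, v τ = 0 := by
      intro τ hτ
      by_contra hne
      have := hB.pos _ (hU τ hτ) _ hne
      rw [hspeed τ hτ, ← h0] at this
      norm_num at this
    rw [hv0 s hsI, hv0 t htI]; simp
  have hBc : ContinuousOn B U := hB.contDiffOn.continuousOn
  have hDBc : ContinuousOn (fderiv ℝ B) U :=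
    hB.contDiffOn.continuousOn_fderiv_of_isOpen hB.isOpen (by simp)
  -- Du Bois-Reymond argument: vary u along Y = ηW with η' = h - c, where c is the mean of h, so
  -- that η vanishes at both ends. Since W is parallel, the first variation is 2∫(h - c)h = 2∫(h -
  -- c)²; minimality makes it zero, hence h = c.
  set h : ℝ → ℝ := fun τ => B (u τ) (v τ) (W τ) with hh
  have hhc : ContinuousOn h (Icc s t) :=
    ((hBc.comp hu.continuousOn hU).clm_apply hu.continuousOn_deriv).clm_apply hW.continuousOn
  have hhi : IntervalIntegrable h volume s t := hhc.intervalIntegrable_of_Icc hst.le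
  set c := (∫ τ in s..t, h τ) / (t - s) with hc
  have hts : t - s ≠ 0 := by linarith
  have hmean : ∫ τ in s..t, (h τ - c) = 0 := by
    rw [integral_sub hhi (by simp), intervalIntegral.integral_const, smul_eq_mul, hc]
    field_simp
    ring
  suffices hconst : ∀ τ ∈ Icc s t, h τ = c from (hconst s hsI).trans (hconst t htI).symm
  have hhcc : ContinuousOn (fun τ => h τ - c) (Icc s t) := hhc.sub continuousOn_const
  have hη : IsC1Curve (fun τ => ∫ x in s..τ, (h x - c)) (fun τ => h τ - c) s t := by
    refine ⟨fun τ hτ => ?_, hhcc⟩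
    have : Fact (τ ∈ Icc s t) := ⟨hτ⟩
    refine integral_hasDerivWithinAt_right ?_ ?_ (hhcc τ hτ)
    · exact (hhcc.mono (Icc_subset_Icc le_rfl hτ.2)).intervalIntegrable_of_Icc hτ.1
    · exact hhcc.stronglyMeasurableAtFilter_nhdsWithin measurableSet_Icc τ
  set η : ℝ → ℝ := fun τ => ∫ x in s..τ, (h x - c) with hηdef
  have hηs : η s = 0 := by simp [hηdef]
  have hηt : η t = 0 := hmean
  set Y : ℝ → E := fun τ => η τ • W τ with hY
  set Y' : ℝ → E := fun τ => η τ • W' τ + (h τ - c) • W τ with hY'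
  have hYC : IsC1Curve Y Y' s t :=
    ⟨fun τ hτ => (hη.hasDeriv τ hτ).smul (hW.hasDeriv τ hτ),
      (hη.continuousOn.smul hW.continuousOn_deriv).add (hhcc.smul hW.continuousOn)⟩
  obtain ⟨r, hr, hrU⟩ := (isCompact_Icc.image_of_continuousOn hu.continuousOn).exists_thickening_subset_open
    hB.isOpen (image_subset_iff.2 hU)
  obtain ⟨N, hN⟩ := isCompact_Icc.exists_bound_of_continuousOn hYC.continuousOn
  have hN0 : 0 ≤ N := (norm_nonneg _).trans (hN s hsI)
  set ε₀ := r / (N + 1) / 2 with hε₀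
  have hε₀0 : 0 < ε₀ := by positivity
  have hUε : ∀ ε ∈ Icc (-ε₀) ε₀, ∀ τ ∈ Icc s t, u τ + ε • Y τ ∈ U := by
    intro ε hε τ hτ
    refine hrU (Metric.mem_thickening_iff.2 ⟨u τ, mem_image_of_mem u hτ, ?_⟩)
    rw [dist_eq_norm, add_sub_cancel_left, norm_smul]
    calc ‖ε‖ * ‖Y τ‖ ≤ ε₀ * N := by
          gcongr
          · exact abs_le.2 hε
          · exact hN τ hτ
      _ < r := by
          rw [hε₀, div_div, div_mul_eq_mul_div, div_lt_iff₀ (by positivity)]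
          nlinarith
  set e : ℝ → ℝ → ℝ := fun ε τ => B (u τ + ε • Y τ) (v τ + ε • Y' τ) (v τ + ε • Y' τ) with he
  set e' : ℝ → ℝ → ℝ := fun ε τ => fderiv ℝ B (u τ + ε • Y τ) (Y τ) (v τ + ε • Y' τ) (v τ + ε • Y' τ)
      + B (u τ + ε • Y τ) (Y' τ) (v τ + ε • Y' τ)
      + B (u τ + ε • Y τ) (v τ + ε • Y' τ) (Y' τ) with he'
  have hcurve : ∀ ε : ℝ, IsC1Curve (fun τ => u τ + ε • Y τ) (fun τ => v τ + ε • Y' τ) s t :=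
    fun ε => ⟨fun τ hτ => (hu.hasDeriv τ hτ).add ((hYC.hasDeriv τ hτ).const_smul ε),
      hu.continuousOn_deriv.add (hYC.continuousOn_deriv.const_smul ε)⟩
  have hec : ∀ ε ∈ Icc (-ε₀) ε₀, ContinuousOn (e ε) (Icc s t) := fun ε hε =>
    ((hBc.comp (hcurve ε).continuousOn (hUε ε hε)).clm_apply
      (hcurve ε).continuousOn_deriv).clm_apply (hcurve ε).continuousOn_deriv
  have he'c : ContinuousOn (fun x : ℝ × ℝ => e' x.1 x.2) (Icc (-ε₀) ε₀ ×ˢ Icc s t) := by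
    have hsnd : MapsTo (Prod.snd : ℝ × ℝ → ℝ) (Icc (-ε₀) ε₀ ×ˢ Icc s t) (Icc s t) :=
      fun x hx => hx.2
    have c1 : ContinuousOn (fun x : ℝ × ℝ => Y x.2) (Icc (-ε₀) ε₀ ×ˢ Icc s t) :=
      hYC.continuousOn.comp continuousOn_snd hsnd
    have c2 : ContinuousOn (fun x : ℝ × ℝ => Y' x.2) (Icc (-ε₀) ε₀ ×ˢ Icc s t) :=
      hYC.continuousOn_deriv.comp continuousOn_snd hsnd
    have c3 : ContinuousOn (fun x : ℝ × ℝ => u x.2 + x.1 • Y x.2) (Icc (-ε₀) ε₀ ×ˢ Icc s t) :=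
      (hu.continuousOn.comp continuousOn_snd hsnd).add (continuousOn_fst.smul c1)
    have c4 : ContinuousOn (fun x : ℝ × ℝ => v x.2 + x.1 • Y' x.2) (Icc (-ε₀) ε₀ ×ˢ Icc s t) :=
      (hu.continuousOn_deriv.comp continuousOn_snd hsnd).add (continuousOn_fst.smul c2)
    have m3 : MapsTo (fun x : ℝ × ℝ => u x.2 + x.1 • Y x.2) (Icc (-ε₀) ε₀ ×ˢ Icc s t) U :=
      fun x hx => hUε x.1 hx.1 x.2 hx.2
    exact (((((hDBc.comp c3 m3).clm_apply c1).clm_apply c4).clm_apply c4).add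
      (((hBc.comp c3 m3).clm_apply c2).clm_apply c4)).add
      (((hBc.comp c3 m3).clm_apply c4).clm_apply c2)
  obtain ⟨M, hM⟩ := (isCompact_Icc.prod isCompact_Icc).exists_bound_of_continuousOn he'c
  have hnhd : Icc (-ε₀) ε₀ ∈ 𝓝 (0 : ℝ) := Icc_mem_nhds (by linarith) hε₀0
  have h0I : (0 : ℝ) ∈ Icc (-ε₀) ε₀ := ⟨by linarith, hε₀0.le⟩
  have hΙ : uIoc s t ⊆ Icc s t := by rw [uIoc_of_le hst.le]; exact Ioc_subset_Icc_self
  have hderiv := (hasDerivAt_integral_of_dominated_loc_of_deriv_le (μ := volume) (a := s) (b := t)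
    (F := e) (F' := e') (x₀ := 0) (s := Icc (-ε₀) ε₀) (bound := fun _ => M) hnhd
    (by
      filter_upwards [hnhd] with ε hε
      exact ((hec ε hε).mono hΙ).aestronglyMeasurable measurableSet_uIoc)
    ((hec 0 h0I).intervalIntegrable_of_Icc hst.le)
    (((he'c.comp (f := fun τ => ((0 : ℝ), τ)) (by fun_prop)
      (fun τ hτ => ⟨h0I, hΙ hτ⟩)).aestronglyMeasurable measurableSet_uIoc))
    (Eventually.of_forall fun τ hτ ε hε => hM (ε, τ) ⟨hε, hΙ hτ⟩) (by simp)
    (Eventually.of_forall fun τ hτ ε hε =>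
      hB.hasDerivAt_energy_density (hUε ε hε τ (hΙ hτ)))).2
  have he0 : ∫ τ in s..t, e 0 τ = D ^ 2 * (t - s) := by
    rw [integral_congr (g := fun _ => D ^ 2) fun τ hτ => ?_]
    · rw [intervalIntegral.integral_const, smul_eq_mul, mul_comm]
    · rw [uIcc_of_le hst.le] at hτ
      simp only [he, zero_smul, add_zero]
      exact hspeed τ hτ
  have hmin : IsLocalMin (fun ε => ∫ τ in s..t, e ε τ) 0 := by
    filter_upwards [hnhd] with ε hε
    rw [he0]
    have hlen := hρ.le_length _ _ s t hst.le (hcurve ε) (hUε ε hε)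
    simp only [hY, hηs, hηt, zero_smul, smul_zero, add_zero] at hlen
    rw [hdist] at hlen
    have hei : IntervalIntegrable (e ε) volume s t := (hec ε hε).intervalIntegrable_of_Icc hst.le
    -- The inequality 2D·√e ≤ e + D², an equality at constant speed D, turns minimality of length
    -- into minimality of energy, which is differentiable in ε.
    have h2 : ∫ τ in s..t, formNorm (B (u τ + ε • Y τ)) (v τ + ε • Y' τ)
        ≤ ∫ τ in s..t, (e ε τ + D ^ 2) / (2 * D) := by
      refine integral_mono_on hst.le ?_ ((hei.add (by simp)).div_const _) fun τ hτ => ?_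
      · exact (continuousOn_formNorm hBc (hcurve ε).continuousOn (hcurve ε).continuousOn_deriv
          (hUε ε hε)).intervalIntegrable_of_Icc hst.le
      · have hnn := hB.nonneg (hUε ε hε τ hτ) (v τ + ε • Y' τ)
        have hsq := formNorm_sq hnn
        rw [le_div_iff₀ (by positivity)]
        simp only [he]
        rw [← hsq]
        nlinarith [sq_nonneg (formNorm (B (u τ + ε • Y τ)) (v τ + ε • Y' τ) - D)]
    rw [intervalIntegral.integral_div, integral_add hei (by simp),
      intervalIntegral.integral_const, smul_eq_mul] at h2
    have h3 := hlen.trans h2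
    rw [le_div_iff₀ (by positivity)] at h3
    nlinarith
  have hzero := hmin.hasDerivAt_eq_zero hderiv
  -- The terms containing η form η times the parallel equation tested against v and vanish; those
  -- from η' = h - c remain.
  have he'0 : ∀ τ ∈ uIcc s t, e' 0 τ = 2 * ((h τ - c) * h τ) := by
    intro τ hτ
    rw [uIcc_of_le hst.le] at hτ
    have hp := hpar τ hτ
    have sy1 := hB.symm _ (hU τ hτ) (W' τ) (v τ)
    have sy2 := hB.symm _ (hU τ hτ) (W τ) (v τ)
    simp only [he', zero_smul, add_zero, hY, hY', map_add, map_smul, add_apply, smul_apply,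
      smul_eq_mul, hh]
    rw [sy1] at hp ⊢
    rw [sy2]
    linear_combination η τ * hp
  rw [integral_congr he'0, intervalIntegral.integral_const_mul] at hzero
  have hsqz : ∫ τ in s..t, (h τ - c) ^ 2 = 0 := by
    have i1 : IntervalIntegrable (fun τ => (h τ - c) * h τ) volume s t :=
      (hhcc.mul hhc).intervalIntegrable_of_Icc hst.le
    have i2 : IntervalIntegrable (fun τ => c * (h τ - c)) volume s t :=
      (continuousOn_const.mul hhcc).intervalIntegrable_of_Icc hst.le
    calc ∫ τ in s..t, (h τ - c) ^ 2 = ∫ τ in s..t, ((h τ - c) * h τ - c * (h τ - c)) := by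
          congr 1; ext τ; ring
      _ = 0 := by
          rw [integral_sub i1 i2, intervalIntegral.integral_const_mul, hmean]
          linarith
  intro τ hτ
  by_contra hne
  have : 0 < ∫ τ in s..t, (h τ - c) ^ 2 :=
    integral_pos hst (hhcc.pow 2) (fun x _ => sq_nonneg _)
      ⟨τ, hτ, by have := sub_ne_zero.2 hne; positivity⟩
  linarith

end Coordinates

/-! ### Christoffel symbols and parallel fields along geodesics in coordinates. -/

section Coordinates

variable {E : Type*} [NormedAddCommGroup E] [NormedSpace ℝ E]
variable {U : Set E} {B : E → E →L[ℝ] E →L[ℝ] ℝ} {ρ : E → E → ℝ}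

set_option maxSynthPendingDepth 3 in
/-- The Christoffel symbols of the first kind of the metric with derivative `T`, as a map in the
last two slots. -/
def christoffelMap (T : E →L[ℝ] E →L[ℝ] E →L[ℝ] ℝ) (a : E) : E →L[ℝ] E →L[ℝ] ℝ :=
  (1 / 2 : ℝ) • (T a + T.flip a - (T.flip a).flip)

set_option maxSynthPendingDepth 3 in
theorem christoffelMap_apply (T : E →L[ℝ] E →L[ℝ] E →L[ℝ] ℝ) (a b c : E) :
    christoffelMap T a b c = 1 / 2 * (T a b c + T b a c - T c a b) := by
  simp [christoffelMap]

set_option maxSynthPendingDepth 3 in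
theorem continuousOn_christoffelMap {T : ℝ → E →L[ℝ] E →L[ℝ] E →L[ℝ] ℝ} {a : ℝ → E} {s : Set ℝ}
    (hT : ContinuousOn T s) (ha : ContinuousOn a s) :
    ContinuousOn (fun t => christoffelMap (T t) (a t)) s := by
  have hflip : ContinuousOn (fun t => (T t).flip (a t)) s :=
    ((ContinuousLinearMap.flipₗᵢ ℝ E E (E →L[ℝ] ℝ)).continuous.comp_continuousOn hT).clm_apply ha
  exact (((hT.clm_apply ha).add hflip).sub
    ((ContinuousLinearMap.flipₗᵢ ℝ E E ℝ).continuous.comp_continuousOn hflip)).const_smul (1 / 2 : ℝ)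

set_option maxSynthPendingDepth 3 in
theorem IsCoordMetric.fderiv_apply (hB : IsCoordMetric U B) {p : E} (hp : p ∈ U) (a b c : E) :
    fderiv ℝ (fun q => B q b c) p a = fderiv ℝ B p a b c := by
  have hd : HasFDerivAt B (fderiv ℝ B p) p :=
    ((hB.contDiffOn.contDiffAt (hB.isOpen.mem_nhds hp)).differentiableAt (by simp)).hasFDerivAt
  have h2 := (hd.clm_apply (hasFDerivAt_const b p)).clm_apply (hasFDerivAt_const c p)
  rw [h2.fderiv]
  simp

set_option maxSynthPendingDepth 3 in
theorem IsCoordMetric.fderiv_symm (hB : IsCoordMetric U B) {p : E} (hp : p ∈ U) (a b c : E) :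
    fderiv ℝ B p a b c = fderiv ℝ B p a c b := by
  rw [← hB.fderiv_apply hp, ← hB.fderiv_apply hp]
  have : (fun q => B q b c) =ᶠ[𝓝 p] fun q => B q c b := by
    filter_upwards [hB.isOpen.mem_nhds hp] with q hq using hB.symm q hq b c
  rw [this.fderiv_eq]

/-- A positive definite form is injective into the dual, hence bijective by dimension. This allows
the parallel equation to be solved for W'. -/
theorem IsCoordMetric.exists_equiv [FiniteDimensional ℝ E] (hB : IsCoordMetric U B) {p : E}
    (hp : p ∈ U) : ∃ e : E ≃L[ℝ] (E →L[ℝ] ℝ), (e : E →L[ℝ] E →L[ℝ] ℝ) = B p := by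
  have hinj : Function.Injective (B p : E →ₗ[ℝ] E →L[ℝ] ℝ) := by
    rw [injective_iff_map_eq_zero]
    intro a ha
    by_contra hne
    have h1 := hB.pos p hp a hne
    have h2 : B p a = 0 := ha
    rw [h2] at h1
    simp at h1
  have hdim : Module.finrank ℝ E = Module.finrank ℝ (E →L[ℝ] ℝ) := by
    rw [← (LinearMap.toContinuousLinearMap : (E →ₗ[ℝ] ℝ) ≃ₗ[ℝ] E →L[ℝ] ℝ).finrank_eq]
    exact (Subspace.dual_finrank_eq (K := ℝ) (V := E)).symm
  refine ⟨(LinearEquiv.ofInjectiveOfFinrankEq (B p : E →ₗ[ℝ] E →L[ℝ] ℝ) hinj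
    hdim).toContinuousLinearEquiv, ?_⟩
  ext a b
  rfl

set_option maxSynthPendingDepth 3 in
/-- A curve that is isometric up to scaling is locally of class `C¹` with constant speed, and short
pieces of it carry parallel fields with arbitrary initial value, whose inner product with the
velocity is constant. -/
theorem IsLocalLengthDist.exists_parallel [FiniteDimensional ℝ E] (hB : IsCoordMetric U B)
    (hρ : IsLocalLengthDist U B ρ) (hρ0 : ∀ p q, 0 ≤ ρ p q) {u : ℝ → E} {t₀ η D : ℝ} (hη : 0 < η)
    (hD : 0 ≤ D) (hu : ContinuousOn u (Ioo (t₀ - η) (t₀ + η))) (hu₀ : u t₀ ∈ U)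
    (hud : ∀ s ∈ Ioo (t₀ - η) (t₀ + η), ∀ t ∈ Ioo (t₀ - η) (t₀ + η),
      ρ (u s) (u t) = |s - t| * D) :
    ∃ δ > 0, δ ≤ η ∧ ∃ v : ℝ → E,
      (∀ t ∈ Ioo (t₀ - δ) (t₀ + δ), u t ∈ U ∧ HasDerivAt u (v t) t ∧
        B (u t) (v t) (v t) = D ^ 2) ∧
      ∀ s ∈ Ioo (t₀ - δ) (t₀ + δ), ∀ t ∈ Ioo (t₀ - δ) (t₀ + δ), s < t → ∀ w : E,
        ∃ W W' : ℝ → E, W s = w ∧ IsC1Curve W W' s t ∧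
          (∀ τ ∈ Icc s t, ∀ c, B (u τ) (W' τ) c
            + christoffelMap (fderiv ℝ B (u τ)) (v τ) (W τ) c = 0) ∧
          B (u s) (v s) (W s) = B (u t) (v t) (W t) := by
  have : CompleteSpace E := FiniteDimensional.complete ℝ E
  obtain ⟨δ₁, hδ₁, hδ₁η, v, hvc, hv⟩ := hρ.exists_velocity hB hρ0 hη hD hu hu₀ hud
  set J := Ioo (t₀ - δ₁) (t₀ + δ₁) with hJ
  have ht₀ : t₀ ∈ J := ⟨by linarith, by linarith⟩
  have hBc : ContinuousOn B U := hB.contDiffOn.continuousOn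
  have hDBc : ContinuousOn (fderiv ℝ B) U :=
    hB.contDiffOn.continuousOn_fderiv_of_isOpen hB.isOpen (by simp)
  have huc : ContinuousOn u J := fun t ht => (hv t ht).2.1.continuousAt.continuousWithinAt
  have huU : MapsTo u J U := fun t ht => (hv t ht).1
  -- Raising the index in the parallel equation gives the linear equation W' = A W; inversion is
  -- continuous at invertible maps, so A is continuous.
  set A : ℝ → E →L[ℝ] E := fun t =>
    -((ContinuousLinearMap.inverse (B (u t))).comp (christoffelMap (fderiv ℝ B (u t)) (v t)))
    with hA
  have hinv : ContinuousOn (fun t => ContinuousLinearMap.inverse (B (u t))) J := by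
    intro t ht
    obtain ⟨e, he⟩ := hB.exists_equiv (huU ht)
    have h1 : ContinuousAt ContinuousLinearMap.inverse (B (u t)) := by
      rw [← he]
      exact (contDiffAt_map_inverse (n := 0) e).continuousAt
    exact ContinuousAt.comp_continuousWithinAt (f := fun t => B (u t)) h1 ((hBc.comp huc huU) t ht)
  have hAc : ContinuousOn A J :=
    (hinv.clm_comp (continuousOn_christoffelMap (hDBc.comp huc huU) hvc)).neg
  have hAB : ∀ t ∈ J, ∀ w, B (u t) (A t w) = -christoffelMap (fderiv ℝ B (u t)) (v t) w := by
    intro t ht w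
    obtain ⟨e, he⟩ := hB.exists_equiv (huU ht)
    simp only [hA, neg_apply, ContinuousLinearMap.comp_apply, map_neg]
    rw [← he, ContinuousLinearMap.inverse_equiv]
    simp
  have hAat : ContinuousAt A t₀ := hAc.continuousAt (Ioo_mem_nhds ht₀.1 ht₀.2)
  have hbound : ∀ᶠ t in 𝓝 t₀, ‖A t‖ < ‖A t₀‖ + 1 :=
    hAat.norm.eventually_lt_const (by linarith)
  obtain ⟨δ₂, hδ₂, hball⟩ := Metric.eventually_nhds_iff.1 hbound
  set K := ‖A t₀‖ + 1 with hK
  have hK0 : 0 < K := by positivity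
  -- Subintervals then have length at most 1/(2K), as the linear existence result requires.
  set δ := min δ₁ (min δ₂ (1 / (4 * K))) with hδdef
  have hδ : 0 < δ := by positivity
  have hd1 : δ ≤ δ₁ := min_le_left _ _
  have hd2 : δ ≤ δ₂ := (min_le_right _ _).trans (min_le_left _ _)
  have hd3 : δ ≤ 1 / (4 * K) := (min_le_right _ _).trans (min_le_right _ _)
  have hJδ : Ioo (t₀ - δ) (t₀ + δ) ⊆ J := Ioo_subset_Ioo (by linarith) (by linarith)
  refine ⟨δ, hδ, by linarith, v, fun t ht => hv t (hJδ ht), fun s hs t ht hst w => ?_⟩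
  have hIJ' : Icc s t ⊆ Ioo (t₀ - δ) (t₀ + δ) := Icc_subset_Ioo hs.1 ht.2
  have hIJ : Icc s t ⊆ J := hIJ'.trans hJδ
  have hAK : ∀ τ ∈ Icc s t, ‖A τ‖ ≤ K := by
    intro τ hτ
    have := hIJ' hτ
    refine (hball ?_).le
    rw [Real.dist_eq, abs_lt]
    constructor <;> linarith [this.1, this.2]
  have hsmall : K * (t - s) ≤ 1 / 2 := by
    have h1 : t - s ≤ 2 * (1 / (4 * K)) := by linarith [hs.1, ht.2]
    calc K * (t - s) ≤ K * (2 * (1 / (4 * K))) := by gcongr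
      _ = 1 / 2 := by field_simp; norm_num
  obtain ⟨W, hW0, hW⟩ := exists_linear_ode_solution hst.le (hAc.mono hIJ) hAK hsmall w
  have heq : ∀ τ ∈ Icc s t, ∀ c, B (u τ) (A τ (W τ)) c
      + christoffelMap (fderiv ℝ B (u τ)) (v τ) (W τ) c = 0 := by
    intro τ hτ c
    rw [hAB τ (hIJ hτ)]
    simp
  refine ⟨W, _, hW0, hW, heq, ?_⟩
  have huC : IsC1Curve u v s t :=
    ⟨fun τ hτ => (hv τ (hIJ hτ)).2.1.hasDerivWithinAt, hvc.mono hIJ⟩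
  refine hρ.inner_velocity_parallel hB hst hD huC (fun τ hτ => huU (hIJ hτ))
    (fun τ hτ => (hv τ (hIJ hτ)).2.2) ?_ hW fun τ hτ => ?_
  · have hsub : Ioo (t₀ - δ) (t₀ + δ) ⊆ Ioo (t₀ - η) (t₀ + η) :=
      Ioo_subset_Ioo (by linarith) (by linarith)
    rw [hud s (hsub hs) t (hsub ht), abs_sub_comm, abs_of_pos (by linarith)]
  -- Tested against v itself, the first and third Christoffel terms cancel by symmetry, which leaves
  -- half the derivative of B in the direction W.
  · have h1 := heq τ hτ (v τ)
    rw [christoffelMap_apply, hB.fderiv_symm (huU (hIJ hτ)) (v τ) (v τ) (W τ)] at h1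
    linarith

end Coordinates

/-! ### The coordinate metric of a chart. -/

section Chart

theorem mem_chart_source {d : ℕ} {M : Type*} [TopologicalSpace M]
    [ChartedSpace (EuclideanSpace ℝ (Fin d)) M] {x₀ x : M}
    (hx : x ∈ (extChartAt (𝓡 d) x₀).source) :
    x ∈ (chartAt (EuclideanSpace ℝ (Fin d)) x₀).source := by
  rwa [extChartAt_source] at hx

variable (d : ℕ) {M : Type*} [MetricSpace M] [ChartedSpace (EuclideanSpace ℝ (Fin d)) M]
  [IsManifold (𝓡 d) ∞ M]

/-- The tangent vector at `x` with coordinates `a` in the chart at `x₀`. -/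
def chartLift (x₀ x : M) : EuclideanSpace ℝ (Fin d) →L[ℝ] TangentSpace (𝓡 d) x :=
  (trivializationAt (EuclideanSpace ℝ (Fin d)) (TangentSpace (𝓡 d)) x₀).symmL ℝ x

variable {d}

theorem mem_baseSet_of_mem_source {x₀ x : M} (hx : x ∈ (extChartAt (𝓡 d) x₀).source) :
    x ∈ (trivializationAt (EuclideanSpace ℝ (Fin d)) (TangentSpace (𝓡 d)) x₀).baseSet := by
  rw [TangentBundle.trivializationAt_baseSet]
  exact mem_chart_source hx

theorem chartFrame_eq {x₀ : M} {u : EuclideanSpace ℝ (Fin d)}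
    (hu : u ∈ (extChartAt (𝓡 d) x₀).target) :
    chartFrame d x₀ u = chartLift d x₀ ((extChartAt (𝓡 d) x₀).symm u) := by
  have hs := mem_chart_source ((extChartAt (𝓡 d) x₀).map_target hu)
  rw [chartLift, TangentBundle.symmL_trivializationAt hs, PartialEquiv.right_inv _ hu, chartFrame,
    ModelWithCorners.range_eq_univ, mfderivWithin_univ]

theorem chartVec_chartLift {x₀ x : M} (hx : x ∈ (extChartAt (𝓡 d) x₀).source)
    (a : EuclideanSpace ℝ (Fin d)) : chartVec d x₀ x (chartLift d x₀ x a) = a := by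
  have h := (trivializationAt (EuclideanSpace ℝ (Fin d)) (TangentSpace (𝓡 d))
    x₀).continuousLinearMapAt_symmL (R := ℝ) (mem_baseSet_of_mem_source hx) a
  rwa [TangentBundle.continuousLinearMapAt_trivializationAt (mem_chart_source hx)] at h

theorem chartLift_chartVec {x₀ x : M} (hx : x ∈ (extChartAt (𝓡 d) x₀).source)
    (v : TangentSpace (𝓡 d) x) : chartLift d x₀ x (chartVec d x₀ x v) = v := by
  have h := (trivializationAt (EuclideanSpace ℝ (Fin d)) (TangentSpace (𝓡 d))
    x₀).symmL_continuousLinearMapAt (R := ℝ) (mem_baseSet_of_mem_source hx) v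
  rwa [TangentBundle.continuousLinearMapAt_trivializationAt (mem_chart_source hx)] at h

variable [RiemannianBundle (fun x : M => TangentSpace (𝓡 d) x)]

theorem chartMetric_eq_inner_chartLift {x₀ x : M} (hx : x ∈ (extChartAt (𝓡 d) x₀).source)
    (a b : EuclideanSpace ℝ (Fin d)) :
    chartMetric d x₀ (extChartAt (𝓡 d) x₀ x) a b
      = inner ℝ (chartLift d x₀ x a) (chartLift d x₀ x b) := by
  rw [chartMetric, chartFrame_eq ((extChartAt (𝓡 d) x₀).map_source hx)]
  -- The fibres over e.symm (e x) and over x are different types; generalizing the base point lets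
  -- the equality be substituted.
  have key : ∀ z : M, z = x → inner ℝ (chartLift d x₀ z a) (chartLift d x₀ z b)
      = inner ℝ (chartLift d x₀ x a) (chartLift d x₀ x b) := by
    rintro z rfl; rfl
  exact key _ ((extChartAt (𝓡 d) x₀).left_inv hx)

variable (d) in
/-- The metric in the coordinates of the chart at `x₀`, as a bilinear form. -/
def chartForm (x₀ : M) (u : EuclideanSpace ℝ (Fin d)) :
    EuclideanSpace ℝ (Fin d) →L[ℝ] EuclideanSpace ℝ (Fin d) →L[ℝ] ℝ :=
  LinearMap.toContinuousBilinearMap (LinearMap.mk₂ ℝ (chartMetric d x₀ u)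
    (fun a a' b => by simp only [chartMetric, map_add, inner_add_left])
    (fun c a b => by simp only [chartMetric, map_smul, real_inner_smul_left, smul_eq_mul])
    (fun a b b' => by simp only [chartMetric, map_add, inner_add_right])
    (fun c a b => by simp only [chartMetric, map_smul, real_inner_smul_right, smul_eq_mul]))

theorem chartForm_apply (x₀ : M) (u a b : EuclideanSpace ℝ (Fin d)) :
    chartForm d x₀ u a b = chartMetric d x₀ u a b := rfl

variable [IsContMDiffRiemannianBundle (𝓡 d) ∞ (EuclideanSpace ℝ (Fin d))
      (fun x : M => TangentSpace (𝓡 d) x)]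

/-- With fixed coordinates a, `chartLift` is a smooth section along the inverse chart, being an
inverse trivialization, and the bundle metric is smooth on smooth sections. -/
theorem contDiffOn_chartMetric (x₀ : M) (a b : EuclideanSpace ℝ (Fin d)) :
    ContDiffOn ℝ ∞ (fun u => chartMetric d x₀ u a b) (extChartAt (𝓡 d) x₀).target := by
  have hlift : ∀ a : EuclideanSpace ℝ (Fin d),
      ContMDiffOn 𝓘(ℝ, EuclideanSpace ℝ (Fin d)) ((𝓡 d).prod 𝓘(ℝ, EuclideanSpace ℝ (Fin d))) ∞
      (fun u => (⟨(extChartAt (𝓡 d) x₀).symm u, chartLift d x₀ ((extChartAt (𝓡 d) x₀).symm u) a⟩ :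
        TotalSpace (EuclideanSpace ℝ (Fin d)) (TangentSpace (𝓡 d) : M → Type)))
      (extChartAt (𝓡 d) x₀).target := by
    intro a
    set e := trivializationAt (EuclideanSpace ℝ (Fin d)) (TangentSpace (𝓡 d) : M → Type) x₀ with he
    have hb : ∀ u ∈ (extChartAt (𝓡 d) x₀).target, (extChartAt (𝓡 d) x₀).symm u ∈ e.baseSet :=
      fun u hu => mem_baseSet_of_mem_source ((extChartAt (𝓡 d) x₀).map_target hu)
    have h1 : ContMDiffOn 𝓘(ℝ, EuclideanSpace ℝ (Fin d))
        ((𝓡 d).prod 𝓘(ℝ, EuclideanSpace ℝ (Fin d))) ∞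
        (fun u => ((extChartAt (𝓡 d) x₀).symm u, a)) (extChartAt (𝓡 d) x₀).target :=
      (contMDiffOn_extChartAt_symm x₀).prodMk contMDiffOn_const
    have h2 := (e.contMDiffOn_symm (n := ∞) (IB := 𝓡 d) (𝕜 := ℝ)).comp h1
      (fun u hu => by rw [e.target_eq]; exact ⟨hb u hu, mem_univ _⟩)
    refine h2.congr fun u hu => ?_
    simp only [Function.comp_apply]
    rw [← e.mk_symm (hb u hu), chartLift, e.symmL_apply (hb u hu)]
  have := ContMDiffOn.inner_bundle (hlift a) (hlift b)
  refine (contMDiffOn_iff_contDiffOn.1 this).congr fun u hu => ?_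
  rw [chartMetric, chartFrame_eq hu]

theorem isCoordMetric_chartForm (x₀ : M) :
    IsCoordMetric (extChartAt (𝓡 d) x₀).target (chartForm d x₀) where
  isOpen := isOpen_extChartAt_target x₀
  contDiffOn := by
    rw [contDiffOn_clm_apply]; intro a
    rw [contDiffOn_clm_apply]; intro b
    exact contDiffOn_chartMetric x₀ a b
  symm p _ a b := by
    rw [chartForm_apply, chartForm_apply, chartMetric, chartMetric, real_inner_comm]
  pos p hp a ha := by
    rw [chartForm_apply, chartMetric, chartFrame_eq hp]
    have hs := (extChartAt (𝓡 d) x₀).map_target hp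
    refine real_inner_self_pos.2 fun h => ha ?_
    rw [← chartVec_chartLift hs a, h, map_zero]

theorem christoffel_eq {x₀ : M} {u : EuclideanSpace ℝ (Fin d)}
    (hu : u ∈ (extChartAt (𝓡 d) x₀).target) (a b c : EuclideanSpace ℝ (Fin d)) :
    christoffel d x₀ u a b c = christoffelMap (fderiv ℝ (chartForm d x₀) u) a b c := by
  have hB := isCoordMetric_chartForm x₀ (M := M) (d := d)
  rw [christoffel, christoffelMap_apply, ← hB.fderiv_apply hu, ← hB.fderiv_apply hu,
    ← hB.fderiv_apply hu]
  rfl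

end Chart

/-! ### The Riemannian distance as a length distance in charts. -/

section Distance

open Manifold MeasureTheory

theorem IsC1Curve.contDiffOn {E : Type*} [NormedAddCommGroup E] [NormedSpace ℝ E] {c c' : ℝ → E}
    {a b : ℝ} (h : IsC1Curve c c' a b) (hab : a < b) : ContDiffOn ℝ 1 c (Icc a b) := by
  have hu : UniqueDiffOn ℝ (Icc a b) := uniqueDiffOn_Icc hab
  rw [show (1 : WithTop ℕ∞) = 0 + 1 by simp, contDiffOn_succ_iff_derivWithin hu]
  refine ⟨fun t ht => (h.hasDeriv t ht).differentiableWithinAt, by simp, ?_⟩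
  rw [contDiffOn_zero]
  exact h.continuousOn_deriv.congr fun t ht => (h.hasDeriv t ht).derivWithin (hu t ht)

theorem isC1Curve_of_contDiffOn {E : Type*} [NormedAddCommGroup E] [NormedSpace ℝ E] {c : ℝ → E}
    {a b : ℝ} (hab : a < b) (h : ContDiffOn ℝ 1 c (Icc a b)) :
    IsC1Curve c (derivWithin c (Icc a b)) a b :=
  ⟨fun t ht => ((h.differentiableOn one_ne_zero) t ht).hasDerivWithinAt,
    h.continuousOn_derivWithin (uniqueDiffOn_Icc hab) le_rfl⟩

variable {d : ℕ} {M : Type*} [MetricSpace M] [ChartedSpace (EuclideanSpace ℝ (Fin d)) M]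
  [RiemannianBundle (fun x : M => TangentSpace (𝓡 d) x)] [IsRiemannianManifold (𝓡 d) M]

theorem dist_le_of_pathELength_lt {γ : ℝ → M} {a b : ℝ} (hγ : ContMDiffOn 𝓘(ℝ, ℝ) (𝓡 d) 1 γ (Icc a b))
    {s t L : ℝ} (has : a ≤ s) (hst : s ≤ t) (htb : t ≤ b)
    (hL : pathELength (𝓡 d) γ a b < ENNReal.ofReal L) :
    edist (γ s) (γ t) ≤ pathELength (𝓡 d) γ s t ∧ dist (γ s) (γ t) < L := by
  have h1 : edist (γ s) (γ t) ≤ pathELength (𝓡 d) γ s t := by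
    rw [IsRiemannianManifold.out (I := 𝓡 d) (γ s) (γ t)]
    exact riemannianEDist_le_pathELength (hγ.mono (Icc_subset_Icc has htb)) rfl rfl hst
  refine ⟨h1, ?_⟩
  have h2 : edist (γ s) (γ t) < ENNReal.ofReal L :=
    (h1.trans (pathELength_mono has htb)).trans_lt hL
  rwa [edist_dist, ENNReal.ofReal_lt_ofReal_iff_of_nonneg dist_nonneg] at h2

/-- The metric distance is finite and equals the infimum of path lengths, so connecting paths exist;
connectedness is thus built into the metric structure. -/
theorem exists_path_of_dist_lt {x y : M} {L : ℝ} (hL : dist x y < L) :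
    ∃ γ : ℝ → M, γ 0 = x ∧ γ 1 = y ∧ ContMDiffOn 𝓘(ℝ, ℝ) (𝓡 d) 1 γ (Icc 0 1) ∧
      pathELength (𝓡 d) γ 0 1 < ENNReal.ofReal L := by
  refine exists_lt_of_riemannianEDist_lt ?_
  rw [← IsRiemannianManifold.out (I := 𝓡 d) x y, edist_dist,
    ENNReal.ofReal_lt_ofReal_iff_of_nonneg dist_nonneg]
  exact hL

/-- On a path of length below d(x, y) + ε, the intermediate value theorem finds a point at distance
r from x; what remains of the path has length below d(x, y) + ε - r. -/
theorem hasApproxBetween_of_isRiemannianManifold (d : ℕ) (M : Type*) [MetricSpace M]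
    [ChartedSpace (EuclideanSpace ℝ (Fin d)) M]
    [RiemannianBundle (fun x : M => TangentSpace (𝓡 d) x)] [IsRiemannianManifold (𝓡 d) M] :
    HasApproxBetween M := by
  intro x y r hr hr' ε hε
  obtain ⟨γ, h0, h1, hγ, hlen⟩ := exists_path_of_dist_lt (d := d)
    (show dist x y < dist x y + ε by linarith)
  have hcont : ContinuousOn (fun t => dist x (γ t)) (Icc 0 1) :=
    Continuous.comp_continuousOn (g := fun z => dist x z) (by fun_prop) hγ.continuousOn
  obtain ⟨t, ht, hxt⟩ := intermediate_value_Icc (zero_le_one' ℝ) hcont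
    (show r ∈ Icc (dist x (γ 0)) (dist x (γ 1)) by rw [h0, h1, dist_self]; exact ⟨hr, hr'⟩)
  refine ⟨γ t, hxt, ?_⟩
  have e1 := (dist_le_of_pathELength_lt hγ le_rfl ht.1 ht.2 hlen).1
  have e2 := (dist_le_of_pathELength_lt hγ ht.1 ht.2 le_rfl hlen).1
  have hsum : edist (γ 0) (γ t) + edist (γ t) (γ 1) < ENNReal.ofReal (dist x y + ε) :=
    ((add_le_add e1 e2).trans_eq (pathELength_add ht.1 ht.2)).trans_lt hlen
  rw [edist_dist, edist_dist, ← ENNReal.ofReal_add dist_nonneg dist_nonneg,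
    ENNReal.ofReal_lt_ofReal_iff_of_nonneg (add_nonneg dist_nonneg dist_nonneg), h0, h1] at hsum
  simp only at hxt
  linarith

variable [IsManifold (𝓡 d) ∞ M]
  [IsContMDiffRiemannianBundle (𝓡 d) ∞ (EuclideanSpace ℝ (Fin d))
      (fun x : M => TangentSpace (𝓡 d) x)]

omit [IsRiemannianManifold (𝓡 d) M] in
theorem pathELength_symm_comp {x₀ : M} {c c' : ℝ → EuclideanSpace ℝ (Fin d)} {a b : ℝ}
    (hab : a < b) (hc : IsC1Curve c c' a b)
    (hct : ∀ t ∈ Icc a b, c t ∈ (extChartAt (𝓡 d) x₀).target) :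
    pathELength (𝓡 d) (fun t => (extChartAt (𝓡 d) x₀).symm (c t)) a b
      = ENNReal.ofReal (∫ t in a..b, formNorm (chartForm d x₀ (c t)) (c' t)) := by
  have hB := isCoordMetric_chartForm (d := d) x₀
  have hfc : ContinuousOn (fun t => formNorm (chartForm d x₀ (c t)) (c' t)) (Icc a b) :=
    continuousOn_formNorm hB.contDiffOn.continuousOn hc.continuousOn hc.continuousOn_deriv hct
  rw [pathELength_eq_lintegral_mfderivWithin_Icc, intervalIntegral.integral_of_le hab.le,
    ← integral_Icc_eq_integral_Ioc,
    ofReal_integral_eq_lintegral_ofReal (hfc.integrableOn_compact isCompact_Icc)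
      (Eventually.of_forall fun t => formNorm_nonneg _ _)]
  refine setLIntegral_congr_fun measurableSet_Icc fun t ht => ?_
  have hsymm : MDifferentiableAt 𝓘(ℝ, EuclideanSpace ℝ (Fin d)) (𝓡 d) (extChartAt (𝓡 d) x₀).symm
      (c t) :=
    ((contMDiffOn_extChartAt_symm (n := ∞) x₀).contMDiffAt
      ((isOpen_extChartAt_target x₀).mem_nhds (hct t ht))).mdifferentiableAt (by simp)
  have hcd : HasMFDerivWithinAt 𝓘(ℝ, ℝ) 𝓘(ℝ, EuclideanSpace ℝ (Fin d)) c (Icc a b) t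
      (ContinuousLinearMap.toSpanSingleton ℝ (c' t)) :=
    (hc.hasDeriv t ht).hasFDerivWithinAt.hasMFDerivWithinAt
  have hcomp := (hsymm.hasMFDerivAt.comp_hasMFDerivWithinAt t hcd).mfderivWithin
    (uniqueMDiffWithinAt_iff_uniqueDiffWithinAt.2 (uniqueDiffOn_Icc hab t ht))
  have hval : mfderivWithin 𝓘(ℝ, ℝ) (𝓡 d) (fun t => (extChartAt (𝓡 d) x₀).symm (c t)) (Icc a b) t 1
      = chartFrame d x₀ (c t) (c' t) := by
    have := DFunLike.congr_fun hcomp (1 : ℝ)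
    refine this.trans ?_
    change chartFrame d x₀ (c t) ((1 : ℝ) • c' t) = _
    rw [one_smul]
  rw [hval, ← ofReal_norm, norm_eq_sqrt_real_inner]
  rfl

/-- In the coordinates of a chart, the distance of a Riemannian manifold is the length distance of
the coordinate metric. -/
theorem isLocalLengthDist_chart (x₀ : M) :
    IsLocalLengthDist (extChartAt (𝓡 d) x₀).target (chartForm d x₀)
      (fun p q => dist ((extChartAt (𝓡 d) x₀).symm p) ((extChartAt (𝓡 d) x₀).symm q)) where
  le_length := by
    intro c c' a b hab hc hct
    rcases hab.eq_or_lt with rfl | hab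
    · simp
    have hsm : ContMDiffOn 𝓘(ℝ, ℝ) (𝓡 d) 1 (fun t => (extChartAt (𝓡 d) x₀).symm (c t)) (Icc a b) :=
      ((contMDiffOn_extChartAt_symm (n := ∞) x₀).of_le (by simp)).comp
        (hc.contDiffOn hab).contMDiffOn hct
    have h1 := riemannianEDist_le_pathELength hsm rfl rfl hab.le
    rw [← IsRiemannianManifold.out (I := 𝓡 d), pathELength_symm_comp hab hc hct, edist_dist] at h1
    exact (ENNReal.ofReal_le_ofReal_iff (intervalIntegral.integral_nonneg hab.le
      fun t _ => formNorm_nonneg _ _)).1 h1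
  exists_curve := by
    intro p₀ hp₀ V hV
    set e := extChartAt (𝓡 d) x₀ with he
    have hsrc : e.symm p₀ ∈ e.source := e.map_target hp₀
    have hN : e ⁻¹' V ∩ e.source ∈ 𝓝 (e.symm p₀) := by
      refine inter_mem ((continuousAt_extChartAt' hsrc).preimage_mem_nhds ?_)
        ((isOpen_extChartAt_source x₀).mem_nhds hsrc)
      rwa [← he, e.right_inv hp₀]
    obtain ⟨ε, hε, hball⟩ := Metric.mem_nhds_iff.1 hN
    -- Points of the ε/4-ball are joined by paths shorter than ε/2, which stay in the ε-ball and so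
    -- in the chart.
    refine ⟨e.target ∩ e.symm ⁻¹' Metric.ball (e.symm p₀) (ε / 4), ?_, ?_⟩
    · exact inter_mem ((isOpen_extChartAt_target x₀).mem_nhds hp₀)
        ((continuousAt_extChartAt_symm'' hp₀).preimage_mem_nhds
          (Metric.ball_mem_nhds _ (by positivity)))
    rintro p ⟨hpt, hpb⟩ q ⟨hqt, hqb⟩ L hL
    rw [mem_preimage, Metric.mem_ball] at hpb hqb
    have hpq : dist (e.symm p) (e.symm q) < min L (ε / 2) :=
      lt_min hL (by linarith [dist_triangle_right (e.symm p) (e.symm q) (e.symm p₀)])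
    obtain ⟨γ, h0, h1, hγ, hlen⟩ := exists_path_of_dist_lt (d := d) hpq
    have hγb : ∀ t ∈ Icc (0 : ℝ) 1, e (γ t) ∈ V ∧ γ t ∈ e.source := by
      intro t ht
      refine hball (Metric.mem_ball.2 ?_)
      have := (dist_le_of_pathELength_lt hγ le_rfl ht.1 ht.2 hlen).2
      rw [h0, dist_comm] at this
      linarith [dist_triangle (γ t) (e.symm p) (e.symm p₀), min_le_right L (ε / 2)]
    have hcd : ContDiffOn ℝ 1 (fun t => e (γ t)) (Icc 0 1) := by
      rw [← contMDiffOn_iff_contDiffOn]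
      exact ((contMDiffOn_extChartAt (n := ∞) (x := x₀)).of_le (by simp)).comp hγ
        fun t ht => mem_chart_source (hγb t ht).2
    have hC := isC1Curve_of_contDiffOn zero_lt_one hcd
    refine ⟨_, _, hC, by rw [h0, e.right_inv hpt], by rw [h1, e.right_inv hqt],
      fun t ht => (hγb t ht).1, ?_⟩
    have hlen2 := pathELength_symm_comp (x₀ := x₀) zero_lt_one hC
      fun t ht => e.map_source (hγb t ht).2
    rw [pathELength_congr (γ' := γ) fun t ht => e.left_inv (hγb t ht).2] at hlen2
    rw [hlen2] at hlen
    exact ((ENNReal.ofReal_lt_ofReal_iff_of_nonneg (intervalIntegral.integral_nonneg zero_le_one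
      fun t _ => formNorm_nonneg _ _)).1 hlen).le.trans (min_le_left _ _)

end Distance

/-! ### Velocity and parallel transport along minimizing geodesics. -/

section Geodesic

variable {d : ℕ} {M : Type*} [MetricSpace M] [ChartedSpace (EuclideanSpace ℝ (Fin d)) M]
  [IsManifold (𝓡 d) ∞ M] [RiemannianBundle (fun x : M => TangentSpace (𝓡 d) x)]

theorem inner_riemGrad (φ : M → ℝ) (x : M) (v : TangentSpace (𝓡 d) x) :
    inner ℝ (riemGrad d φ x) v = mfderiv (𝓡 d) 𝓘(ℝ, ℝ) φ x v := by
  have : CompleteSpace (TangentSpace (𝓡 d) x) := tangentSpace_complete d x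
  exact InnerProductSpace.toDual_symm_apply

omit [RiemannianBundle (fun x : M => TangentSpace (𝓡 d) x)] in
/-- The chain rule for a function along a curve given in coordinates. -/
theorem hasDerivAt_comp_of_chart {x₀ : M} {γ : ℝ → M} {v : EuclideanSpace ℝ (Fin d)} {t : ℝ}
    (hγ : ∀ᶠ s in 𝓝 t, γ s ∈ (extChartAt (𝓡 d) x₀).source)
    (hv : HasDerivAt (fun s => extChartAt (𝓡 d) x₀ (γ s)) v t) {φ : M → ℝ}
    (hφ : MDifferentiableAt (𝓡 d) 𝓘(ℝ, ℝ) φ (γ t)) :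
    HasDerivAt (fun s => φ (γ s))
      (mfderiv (𝓡 d) 𝓘(ℝ, ℝ) φ (γ t) (chartLift d x₀ (γ t) v)) t := by
  set e := extChartAt (𝓡 d) x₀ with he
  have hsrc : γ t ∈ e.source := hγ.self_of_nhds
  have htgt : e (γ t) ∈ e.target := e.map_source hsrc
  have hinv : e.symm (e (γ t)) = γ t := e.left_inv hsrc
  have hsymm : MDifferentiableAt 𝓘(ℝ, EuclideanSpace ℝ (Fin d)) (𝓡 d) e.symm (e (γ t)) :=
    ((contMDiffOn_extChartAt_symm (n := ∞) x₀).contMDiffAt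
      ((isOpen_extChartAt_target x₀).mem_nhds htgt)).mdifferentiableAt (by simp)
  have hφ' : MDifferentiableAt (𝓡 d) 𝓘(ℝ, ℝ) φ (e.symm (e (γ t))) := by rwa [hinv]
  have hcomp := (hφ'.hasMFDerivAt.comp (e (γ t)) hsymm.hasMFDerivAt).hasFDerivAt
  have h1 := hcomp.comp_hasDerivAt t hv
  have hval : mfderiv (𝓡 d) 𝓘(ℝ, ℝ) φ (e.symm (e (γ t))) (chartFrame d x₀ (e (γ t)) v)
      = mfderiv (𝓡 d) 𝓘(ℝ, ℝ) φ (γ t) (chartLift d x₀ (γ t) v) := by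
    rw [chartFrame_eq htgt]
    have key : ∀ z : M, z = γ t → mfderiv (𝓡 d) 𝓘(ℝ, ℝ) φ z (chartLift d x₀ z v)
        = mfderiv (𝓡 d) 𝓘(ℝ, ℝ) φ (γ t) (chartLift d x₀ (γ t) v) := by
      rintro z rfl; rfl
    exact key _ hinv
  have h2 : HasDerivAt (fun s => φ (e.symm (e (γ s))))
      (mfderiv (𝓡 d) 𝓘(ℝ, ℝ) φ (γ t) (chartLift d x₀ (γ t) v)) t := by
    rw [← hval]; exact h1
  refine h2.congr_of_eventuallyEq ?_
  filter_upwards [hγ] with s hs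
  rw [e.left_inv hs]

variable [IsContMDiffRiemannianBundle (𝓡 d) ∞ (EuclideanSpace ℝ (Fin d))
      (fun x : M => TangentSpace (𝓡 d) x)]

set_option maxSynthPendingDepth 3 in
/-- A solution of the parallel transport equation in a chart gives a parallel transport along a
reparametrized piece of the curve. -/
theorem isParallelTransport_of_chart {x₀ : M} {γ : ℝ → M} {v W W' : ℝ → EuclideanSpace ℝ (Fin d)}
    {s t : ℝ} (hst : s < t) (hγ : ContinuousOn γ (Icc s t))
    (hsrc : ∀ τ ∈ Icc s t, γ τ ∈ (extChartAt (𝓡 d) x₀).source)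
    (hv : ∀ τ ∈ Icc s t, HasDerivAt (fun r => extChartAt (𝓡 d) x₀ (γ r)) (v τ) τ)
    (hW : IsC1Curve W W' s t)
    (hpar : ∀ τ ∈ Icc s t, ∀ c, chartForm d x₀ (extChartAt (𝓡 d) x₀ (γ τ)) (W' τ) c
      + christoffelMap (fderiv ℝ (chartForm d x₀) (extChartAt (𝓡 d) x₀ (γ τ))) (v τ) (W τ) c = 0) :
    IsParallelTransport (fun τ => γ (s + τ * (t - s)))
      (chartLift d x₀ (γ (s + 0 * (t - s))) (W (s + 0 * (t - s))))
      (chartLift d x₀ (γ (s + 1 * (t - s))) (W (s + 1 * (t - s)))) := by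
  have hmap : MapsTo (fun τ : ℝ => s + τ * (t - s)) (Icc 0 1) (Icc s t) := fun τ hτ =>
    ⟨by nlinarith [hτ.1], by nlinarith [hτ.2]⟩
  have haff : ∀ τ, HasDerivAt (fun τ : ℝ => s + τ * (t - s)) (t - s) τ := fun τ => by
    simpa using ((hasDerivAt_id τ).mul_const (t - s)).const_add s
  refine ⟨fun τ => chartLift d x₀ (γ (s + τ * (t - s))) (W (s + τ * (t - s))),
    ⟨hγ.comp (by fun_prop) hmap, fun τ hτ => ?_⟩, rfl, rfl⟩
  have hm := hmap hτ
  simp only at hm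
  -- Reparametrization scales the velocity and W' by the same factor, and both terms of the parallel
  -- equation are homogeneous in it.
  refine ⟨x₀, hsrc _ hm, (t - s) • v (s + τ * (t - s)), (t - s) • W' (s + τ * (t - s)), ?_, ?_, ?_⟩
  · exact ((hv _ hm).scomp τ (haff τ)).hasDerivWithinAt
  · have h1 := (hW.hasDeriv _ hm).scomp τ (haff τ).hasDerivWithinAt hmap
    refine h1.congr (fun r hr => ?_) ?_
    · exact chartVec_chartLift (hsrc _ (hmap hr)) _
    · exact chartVec_chartLift (hsrc _ hm) _
  · intro c
    have h1 := hpar _ hm c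
    rw [chartVec_chartLift (hsrc _ hm),
      christoffel_eq ((extChartAt (𝓡 d) x₀).map_source (hsrc _ hm)), ← chartForm_apply, map_smul,
      smul_apply, christoffelMap_apply]
    rw [christoffelMap_apply] at h1
    simp only [map_smul, smul_apply, smul_eq_mul]
    linear_combination (t - s) * h1

variable [IsRiemannianManifold (𝓡 d) M]

/-- Minimizing geodesics are differentiable in the interior of their domain, with constant speed;
short pieces of them admit parallel transport of any tangent vector, and parallel transport
preserves the inner product with the velocity. -/
theorem IsMinGeodesic.exists_local_transport {γ : ℝ → M} (hγ : IsMinGeodesic γ) {t₀ : ℝ}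
    (ht₀ : t₀ ∈ Ioo (0 : ℝ) 1) :
    ∃ δ > 0, Ioo (t₀ - δ) (t₀ + δ) ⊆ Ioo 0 1 ∧ ∃ ν : ∀ t, TangentSpace (𝓡 d) (γ t),
      (∀ t ∈ Ioo (t₀ - δ) (t₀ + δ), ‖ν t‖ = dist (γ 0) (γ 1)) ∧
      (∀ t ∈ Ioo (t₀ - δ) (t₀ + δ), ∀ φ : M → ℝ, MDifferentiableAt (𝓡 d) 𝓘(ℝ, ℝ) φ (γ t) →
        HasDerivAt (fun s => φ (γ s)) (inner ℝ (riemGrad d φ (γ t)) (ν t)) t) ∧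
      ∀ s ∈ Ioo (t₀ - δ) (t₀ + δ), ∀ t ∈ Ioo (t₀ - δ) (t₀ + δ), s < t →
        ∀ a : TangentSpace (𝓡 d) (γ (s + 0 * (t - s))),
        ∃ b : TangentSpace (𝓡 d) (γ (s + 1 * (t - s))),
          IsParallelTransport (fun τ => γ (s + τ * (t - s))) a b ∧
          inner ℝ b (ν (s + 1 * (t - s))) = inner ℝ a (ν (s + 0 * (t - s))) := by
  set x₀ := γ t₀ with hx₀
  set e := extChartAt (𝓡 d) x₀ with he
  have hcont : ContinuousAt γ t₀ :=
    hγ.continuousOn.continuousAt (Icc_mem_nhds ht₀.1 ht₀.2)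
  have hev : ∀ᶠ t in 𝓝 t₀, γ t ∈ e.source ∧ t ∈ Ioo (0 : ℝ) 1 :=
    (hcont.eventually (extChartAt_source_mem_nhds (I := 𝓡 d) x₀)).and
      (Ioo_mem_nhds ht₀.1 ht₀.2)
  obtain ⟨η, hη, hball⟩ := Metric.eventually_nhds_iff.1 hev
  have hJ : ∀ t ∈ Ioo (t₀ - η) (t₀ + η), γ t ∈ e.source ∧ t ∈ Ioo (0 : ℝ) 1 := by
    intro t ht
    refine hball ?_
    rw [Real.dist_eq, abs_lt]
    constructor <;> linarith [ht.1, ht.2]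
  have hJ0 : t₀ ∈ Ioo (t₀ - η) (t₀ + η) := ⟨by linarith, by linarith⟩
  have hu : ContinuousOn (fun t => e (γ t)) (Ioo (t₀ - η) (t₀ + η)) := by
    refine (continuousOn_extChartAt x₀).comp (hγ.continuousOn.mono fun t ht => ?_)
      fun t ht => (hJ t ht).1
    exact Ioo_subset_Icc_self (hJ t ht).2
  obtain ⟨δ, hδ, hδη, v, hv, htr⟩ := (isLocalLengthDist_chart (d := d) x₀).exists_parallel
    (isCoordMetric_chartForm x₀) (fun _ _ => dist_nonneg) (u := fun t => e (γ t)) hη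
    (dist_nonneg (x := γ 0) (y := γ 1)) hu (e.map_source (hJ t₀ hJ0).1) (by
      intro s hs t ht
      rw [← he, e.left_inv (hJ s hs).1, e.left_inv (hJ t ht).1]
      exact hγ s (Ioo_subset_Icc_self (hJ s hs).2) t (Ioo_subset_Icc_self (hJ t ht).2))
  have hsub : ∀ t ∈ Ioo (t₀ - δ) (t₀ + δ), t ∈ Ioo (t₀ - η) (t₀ + η) := fun t ht =>
    ⟨by linarith [ht.1], by linarith [ht.2]⟩
  have hsrc : ∀ t ∈ Ioo (t₀ - δ) (t₀ + δ), γ t ∈ e.source := fun t ht => (hJ t (hsub t ht)).1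
  have hinner : ∀ t ∈ Ioo (t₀ - δ) (t₀ + δ), ∀ a b : EuclideanSpace ℝ (Fin d),
      inner ℝ (chartLift d x₀ (γ t) a) (chartLift d x₀ (γ t) b)
        = chartForm d x₀ (e (γ t)) a b := fun t ht a b =>
    (chartMetric_eq_inner_chartLift (hsrc t ht) a b).symm
  refine ⟨δ, hδ, fun t ht => (hJ t (hsub t ht)).2, fun t => chartLift d x₀ (γ t) (v t),
    fun t ht => ?_, fun t ht φ hφ => ?_, fun s hs t ht hst a => ?_⟩
  · rw [norm_eq_sqrt_real_inner, hinner t ht, (hv t ht).2.2, Real.sqrt_sq dist_nonneg]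
  · rw [inner_riemGrad]
    refine hasDerivAt_comp_of_chart ?_ (hv t ht).2.1 hφ
    filter_upwards [Ioo_mem_nhds ht.1 ht.2] with s hs using hsrc s hs
  · have hI : Icc s t ⊆ Ioo (t₀ - δ) (t₀ + δ) := Icc_subset_Ioo hs.1 ht.2
    -- Endpoints stay unsimplified inside tangent space types; these equalities are used only for
    -- memberships and in coordinates.
    have e0 : s + 0 * (t - s) = s := by ring
    have e1 : s + 1 * (t - s) = t := by ring
    obtain ⟨W, W', hW0, hW, hpar, hconst⟩ :=
      htr s hs t ht hst (chartVec d x₀ (γ (s + 0 * (t - s))) a)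
    have hPT := isParallelTransport_of_chart hst
      (hγ.continuousOn.mono fun τ hτ => Ioo_subset_Icc_self (hJ τ (hsub τ (hI hτ))).2)
      (fun τ hτ => hsrc τ (hI hτ)) (fun τ hτ => (hv τ (hI hτ)).2.1) hW hpar
    have ha : chartLift d x₀ (γ (s + 0 * (t - s))) (W (s + 0 * (t - s))) = a := by
      have hW' : W (s + 0 * (t - s)) = chartVec d x₀ (γ (s + 0 * (t - s))) a := by
        rw [← hW0]; congr 1
      rw [hW']
      exact chartLift_chartVec (hsrc _ (by rwa [e0])) a
    refine ⟨_, ha ▸ hPT, ?_⟩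
    rw [hinner _ (by rwa [e1])]
    conv_rhs => rw [← ha]
    rw [hinner _ (by rwa [e0])]
    have hB := isCoordMetric_chartForm (d := d) x₀
    rw [e0, e1, hB.symm _ (e.map_source (hsrc t ht)) (W t),
      hB.symm _ (e.map_source (hsrc s hs)) (W s)]
    exact hconst.symm

end Geodesic

/-! ### Calculus on the unit interval. -/

/-- A locally Lipschitz condition with a uniform constant on `(0, 1)` is a global one. -/
theorem norm_sub_le_of_locally {F : Type*} [NormedAddCommGroup F] {G : ℝ → F} {K : ℝ}
    (h : ∀ t₀ ∈ Ioo (0 : ℝ) 1, ∃ δ > 0, ∀ s ∈ Ioo (t₀ - δ) (t₀ + δ), ∀ t ∈ Ioo (t₀ - δ) (t₀ + δ),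
      s < t → ‖G t - G s‖ ≤ K * (t - s)) {s t : ℝ} (hs : s ∈ Ioo (0 : ℝ) 1)
    (ht : t ∈ Ioo (0 : ℝ) 1) (hst : s < t) : ‖G t - G s‖ ≤ K * (t - s) := by
  have hcont : ∀ t₀ ∈ Ioo (0 : ℝ) 1, ContinuousAt G t₀ := by
    intro t₀ ht₀
    obtain ⟨δ, hδ, hloc⟩ := h t₀ ht₀
    have hmem : t₀ ∈ Ioo (t₀ - δ) (t₀ + δ) := ⟨by linarith, by linarith⟩
    rw [ContinuousAt, tendsto_iff_norm_sub_tendsto_zero]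
    have hlim : Tendsto (fun r : ℝ => K * |r - t₀|) (𝓝 t₀) (𝓝 (K * |t₀ - t₀|)) :=
      Continuous.tendsto (by fun_prop) t₀
    rw [sub_self, abs_zero, mul_zero] at hlim
    refine squeeze_zero' (Eventually.of_forall fun _ => norm_nonneg _) ?_ hlim
    filter_upwards [Ioo_mem_nhds hmem.1 hmem.2] with r hr
    rcases lt_trichotomy r t₀ with hlt | rfl | hlt
    · rw [norm_sub_rev, abs_sub_comm, abs_of_pos (by linarith)]
      exact hloc r hr t₀ hmem hlt
    · simp
    · rw [abs_of_pos (by linarith)]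
      exact hloc t₀ hmem r hr hlt
  have hI : Icc s t ⊆ Ioo 0 1 := Icc_subset_Ioo hs.1 ht.2
  refine image_le_of_liminf_slope_right_le_deriv_boundary (f := fun r => ‖G r - G s‖)
    (B := fun r => K * (r - s)) (B' := fun _ => K) (a := s) (b := t) ?_ (by simp) (by fun_prop) ?_ ?_
    ⟨hst.le, le_rfl⟩
  · exact fun r hr => ((hcont r (hI hr)).sub continuousAt_const).norm.continuousWithinAt
  · intro r _
    simpa using (((hasDerivAt_id r).sub_const s).const_mul K).hasDerivWithinAt
  · intro r hr c hc
    obtain ⟨δ, hδ, hloc⟩ := h r (hI ⟨hr.1, hr.2.le⟩)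
    refine Eventually.frequently ?_
    filter_upwards [Ioo_mem_nhdsGT (show r < r + δ by linarith)] with z hz
    have h1 := hloc r ⟨by linarith, by linarith⟩ z ⟨by linarith [hz.1], hz.2⟩ hz.1
    have h2 : ‖G z - G s‖ - ‖G r - G s‖ ≤ ‖G z - G r‖ :=
      (norm_sub_norm_le _ _).trans_eq (by congr 1; abel)
    rw [slope_def_field, div_lt_iff₀ (by linarith [hz.1])]
    nlinarith [hz.1]

/-- A function on `[0, 1]` with `K`-Lipschitz derivative is within `K / 2 * t * (1 - t)` of its
linear interpolation. -/
theorem abs_sub_interpolation_le {h : ℝ → ℝ} {K : ℝ} (hc : ContinuousOn h (Icc 0 1))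
    (hd : ∀ t ∈ Ioo (0 : ℝ) 1, DifferentiableAt ℝ h t)
    (hK : ∀ s ∈ Ioo (0 : ℝ) 1, ∀ t ∈ Ioo (0 : ℝ) 1, s < t → ‖deriv h t - deriv h s‖ ≤ K * (t - s))
    {t : ℝ} (ht : t ∈ Icc (0 : ℝ) 1) :
    |h t - ((1 - t) * h 0 + t * h 1)| ≤ K / 2 * (t * (1 - t)) := by
  -- Both h and -h become convex after adding K r²/2; σ = 1 and σ = -1 give the two sides of the
  -- estimate.
  have hconv : ∀ σ : ℝ, |σ| ≤ 1 → ConvexOn ℝ (Icc (0 : ℝ) 1) (fun r => σ * h r + K / 2 * r ^ 2) := by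
    intro σ hσ
    have hder : ∀ r ∈ Ioo (0 : ℝ) 1,
        HasDerivAt (fun r => σ * h r + K / 2 * r ^ 2) (σ * deriv h r + K * r) r := by
      intro r hr
      exact (((hd r hr).hasDerivAt.const_mul σ).add
        ((hasDerivAt_pow 2 r).const_mul (K / 2))).congr_deriv (by norm_num; ring)
    refine MonotoneOn.convexOn_of_deriv (convex_Icc 0 1) ?_ ?_ ?_
    · exact (continuousOn_const.mul hc).add (by fun_prop)
    · rw [interior_Icc]
      exact fun r hr => (hder r hr).differentiableAt.differentiableWithinAt
    · rw [interior_Icc]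
      intro a ha b hb hab
      rw [(hder a ha).deriv, (hder b hb).deriv]
      rcases hab.eq_or_lt with rfl | hab
      · exact le_rfl
      have h1 := hK a ha b hb hab
      rw [Real.norm_eq_abs] at h1
      have h2 : |σ * (deriv h b - deriv h a)| ≤ K * (b - a) := by
        rw [abs_mul]
        exact (mul_le_of_le_one_left (abs_nonneg _) hσ).trans h1
      linarith [(abs_le.1 h2).1]
  have happly : ∀ σ : ℝ, |σ| ≤ 1 → σ * h t + K / 2 * t ^ 2
      ≤ (1 - t) * (σ * h 0) + t * (σ * h 1 + K / 2) := by
    intro σ hσ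
    have := (hconv σ hσ).2 (show (0 : ℝ) ∈ Icc 0 1 by simp) (show (1 : ℝ) ∈ Icc 0 1 by simp)
      (show 0 ≤ 1 - t by linarith [ht.2]) ht.1 (by ring)
    simpa using this
  have h1 := happly 1 (by simp)
  have h2 := happly (-1) (by simp)
  rw [abs_le]
  constructor <;> linarith

/-! ### Increments of functions along geodesics of one manifold. -/

section OneManifold

variable {d : ℕ} {N : Type*} [MetricSpace N] [ChartedSpace (EuclideanSpace ℝ (Fin d)) N]
  [IsManifold (𝓡 d) ∞ N] [RiemannianBundle (fun x : N => TangentSpace (𝓡 d) x)]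
  [IsContMDiffRiemannianBundle (𝓡 d) ∞ (EuclideanSpace ℝ (Fin d))
      (fun x : N => TangentSpace (𝓡 d) x)]

set_option maxSynthPendingDepth 3 in
-- Freezing one factor at a point allows the gradient condition on the product to be used along
-- geodesics of the other factor.
theorem isParallelTransport_const (x : N) (v : TangentSpace (𝓡 d) x) :
    IsParallelTransport (fun _ : ℝ => x) v v := by
  refine ⟨fun _ => v, ⟨continuousOn_const, fun t _ => ⟨x, mem_extChartAt_source x, 0, 0,
    hasDerivWithinAt_const _ _ _, hasDerivWithinAt_const _ _ _, fun c => ?_⟩⟩, rfl, rfl⟩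
  rw [christoffel_eq (mem_extChartAt_target x), christoffelMap_apply, ← chartForm_apply]
  simp

variable [IsRiemannianManifold (𝓡 d) N]

/-- Mean value theorem with speed d(γ 0, γ 1). Two functions are allowed so that two slices of one
function can be compared; φ₂ = 0 gives the Lipschitz bound for a single one. -/
theorem IsMinGeodesic.abs_sub_le_of_grad {γ : ℝ → N} (hγ : IsMinGeodesic γ) {φ₁ φ₂ : N → ℝ}
    (h₁ : MDifferentiable (𝓡 d) 𝓘(ℝ, ℝ) φ₁) (h₂ : MDifferentiable (𝓡 d) 𝓘(ℝ, ℝ) φ₂) {k : ℝ}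
    (hk : ∀ y, ‖riemGrad d φ₁ y - riemGrad d φ₂ y‖ ≤ k) :
    |(φ₁ (γ 1) - φ₂ (γ 1)) - (φ₁ (γ 0) - φ₂ (γ 0))| ≤ k * dist (γ 0) (γ 1) := by
  have hder : ∀ t ∈ Ioo (0 : ℝ) 1, ∃ D, HasDerivAt (fun s => φ₁ (γ s) - φ₂ (γ s)) D t ∧
      |D| ≤ k * dist (γ 0) (γ 1) := by
    intro t ht
    obtain ⟨δ, hδ, -, ν, hν, hd, -⟩ := hγ.exists_local_transport (d := d) ht
    have hmem : t ∈ Ioo (t - δ) (t + δ) := ⟨by linarith, by linarith⟩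
    refine ⟨_, (hd t hmem φ₁ (h₁ _)).sub (hd t hmem φ₂ (h₂ _)), ?_⟩
    rw [← inner_sub_left, ← hν t hmem]
    exact (abs_real_inner_le_norm _ _).trans (by gcongr; exact hk _)
  obtain ⟨c, hc, hslope⟩ := exists_deriv_eq_slope (fun s => φ₁ (γ s) - φ₂ (γ s)) (zero_lt_one' ℝ)
    ((h₁.continuous.comp_continuousOn hγ.continuousOn).sub
      (h₂.continuous.comp_continuousOn hγ.continuousOn))
    fun t ht => (hder t ht).choose_spec.1.differentiableAt.differentiableWithinAt
  obtain ⟨D, hD, hDk⟩ := hder c hc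
  rw [hD.deriv, sub_zero, div_one] at hslope
  rwa [← hslope]

end OneManifold

/-! ### Consequences of a Lipschitz gradient on the product. -/

section Product

variable {m n : ℕ}
  {M : Type*} [MetricSpace M] [ChartedSpace (EuclideanSpace ℝ (Fin m)) M]
  [IsManifold (𝓡 m) ∞ M] [RiemannianBundle (fun x : M => TangentSpace (𝓡 m) x)]
  [IsContMDiffRiemannianBundle (𝓡 m) ∞ (EuclideanSpace ℝ (Fin m))
      (fun x : M => TangentSpace (𝓡 m) x)]
  {N : Type*} [MetricSpace N] [ChartedSpace (EuclideanSpace ℝ (Fin n)) N]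
  [IsManifold (𝓡 n) ∞ N] [RiemannianBundle (fun y : N => TangentSpace (𝓡 n) y)]
  [IsContMDiffRiemannianBundle (𝓡 n) ∞ (EuclideanSpace ℝ (Fin n))
      (fun y : N => TangentSpace (𝓡 n) y)]

omit [RiemannianBundle (fun x : M => TangentSpace (𝓡 m) x)]
  [IsContMDiffRiemannianBundle (𝓡 m) ∞ (EuclideanSpace ℝ (Fin m))
      (fun x : M => TangentSpace (𝓡 m) x)] [RiemannianBundle (fun y : N => TangentSpace (𝓡 n) y)]
  [IsContMDiffRiemannianBundle (𝓡 n) ∞ (EuclideanSpace ℝ (Fin n))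
      (fun y : N => TangentSpace (𝓡 n) y)] [IsManifold (𝓡 m) ∞ M] [IsManifold (𝓡 n) ∞ N] in
theorem mdifferentiable_slice {F : M × N → ℝ}
    (hF : ContMDiff ((𝓡 m).prod (𝓡 n)) 𝓘(ℝ, ℝ) 1 F) (x : M) :
    MDifferentiable (𝓡 n) 𝓘(ℝ, ℝ) (fun y => F (x, y)) :=
  (hF.comp (contMDiff_const.prodMk contMDiff_id)).mdifferentiable one_ne_zero

/-- Along geodesics in the second factor, a function with Lipschitz gradient is close to its linear
interpolation. -/
theorem LipschitzGradient.abs_sub_interpolation_le [IsRiemannianManifold (𝓡 n) N] {F : M × N → ℝ}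
    {l : ℝ} (hl : LipschitzGradient m n l F)
    (hF : ContMDiff ((𝓡 m).prod (𝓡 n)) 𝓘(ℝ, ℝ) 1 F) (x : M) {γ : ℝ → N} (hγ : IsMinGeodesic γ)
    {t : ℝ} (ht : t ∈ Icc (0 : ℝ) 1) :
    |F (x, γ t) - ((1 - t) * F (x, γ 0) + t * F (x, γ 1))|
      ≤ l / 2 * (t * (1 - t)) * dist (γ 0) (γ 1) ^ 2 := by
  set φ : N → ℝ := fun y => F (x, y) with hφ
  have hφd : MDifferentiable (𝓡 n) 𝓘(ℝ, ℝ) φ := mdifferentiable_slice hF x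
  set D := dist (γ 0) (γ 1) with hD
  have main := RiemBilevel.abs_sub_interpolation_le (h := fun s => φ (γ s)) (K := l * D ^ 2)
    (hφd.continuous.comp_continuousOn hγ.continuousOn) (fun r hr => ?_) (fun r hr s hs hrs => ?_) ht
  · exact main.trans_eq (by ring)
  · obtain ⟨δ, hδ, -, ν, -, hd, -⟩ := hγ.exists_local_transport (d := n) hr
    exact (hd r ⟨by linarith, by linarith⟩ φ (hφd _)).differentiableAt
  · refine norm_sub_le_of_locally (fun t₀ ht₀ => ?_) hr hs hrs
    obtain ⟨δ, hδ, hsub, ν, hν, hd, htr⟩ := hγ.exists_local_transport (d := n) ht₀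
    refine ⟨δ, hδ, fun a ha b hb hab => ?_⟩
    set σ : ℝ → N := fun τ => γ (a + τ * (b - a)) with hσ
    have hσg : IsMinGeodesic σ := hγ.restrict (hsub ha).1.le hab.le (hsub hb).2.le
    obtain ⟨w, hw, hinner⟩ := htr a ha b hb hab (riemGrad n φ (γ (a + 0 * (b - a))))
    have h1 := hl (fun _ => x) σ (isMinGeodesic_const x) hσg _ w
      (isParallelTransport_const x _) hw
    have hdist : dist (σ 0) (σ 1) = (b - a) * D := by
      simp only [hσ]
      rw [show a + 0 * (b - a) = a by ring, show a + 1 * (b - a) = b by ring,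
        hγ a (Ioo_subset_Icc_self (hsub ha)) b (Ioo_subset_Icc_self (hsub hb)), abs_sub_comm,
        abs_of_pos (by linarith)]
    have hba : 0 ≤ (b - a) * D := mul_nonneg (by linarith) dist_nonneg
    rw [dist_self, hdist, zero_pow two_ne_zero, zero_add, Real.sqrt_sq hba] at h1
    have h2 : ‖w - riemGrad n φ (γ (a + 1 * (b - a)))‖ ≤ l * ((b - a) * D) := by
      refine le_trans ?_ h1
      exact Real.le_sqrt_of_sq_le (le_add_of_nonneg_left (sq_nonneg _))
    set ψ : ℝ → ℝ := fun τ => inner ℝ (riemGrad n φ (γ τ)) (ν τ) with hψ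
    have e0 : a + 0 * (b - a) = a := by ring
    have e1 : a + 1 * (b - a) = b := by ring
    have hbm : a + 1 * (b - a) ∈ Ioo (t₀ - δ) (t₀ + δ) := by rwa [e1]
    -- Transport preserves the inner product with the velocity, so the change of the derivative is
    -- the inner product of the velocity with the gradient minus the transported gradient.
    have h3 : |ψ (a + 1 * (b - a)) - ψ (a + 0 * (b - a))| ≤ l * ((b - a) * D) * D := by
      have : ψ (a + 1 * (b - a)) - ψ (a + 0 * (b - a))
          = inner ℝ (riemGrad n φ (γ (a + 1 * (b - a))) - w) (ν (a + 1 * (b - a))) := by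
        rw [inner_sub_left, hinner]
      rw [this]
      refine (abs_real_inner_le_norm _ _).trans ?_
      rw [norm_sub_rev, hν _ hbm]
      gcongr
    rw [e0, e1] at h3
    rw [(hd b hb φ (hφd _)).deriv, (hd a ha φ (hφd _)).deriv, Real.norm_eq_abs]
    exact h3.trans_eq (by ring)

/-- Lipschitz dependence on the first variable of the increments in the second variable. -/
theorem LipschitzGradient.abs_mixed_difference_le [IsRiemannianManifold (𝓡 m) M]
    [IsRiemannianManifold (𝓡 n) N] {F : M × N → ℝ} {l : ℝ} (hl : LipschitzGradient m n l F)
    (hF : ContMDiff ((𝓡 m).prod (𝓡 n)) 𝓘(ℝ, ℝ) 1 F) {γ : ℝ → M} (hγ : IsMinGeodesic γ)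
    {σ : ℝ → N} (hσ : IsMinGeodesic σ) :
    |(F (γ 1, σ 1) - F (γ 0, σ 1)) - (F (γ 1, σ 0) - F (γ 0, σ 0))|
      ≤ l * dist (γ 0) (γ 1) * dist (σ 0) (σ 1) := by
  set D := dist (γ 0) (γ 1) with hD
  have hgrad : ∀ y : N, ∀ s ∈ Ioo (0 : ℝ) 1, ∀ t ∈ Ioo (0 : ℝ) 1, s < t →
      ‖riemGrad n (fun z => F (γ t, z)) y - riemGrad n (fun z => F (γ s, z)) y‖
        ≤ l * D * (t - s) := by
    intro y s hs t ht hst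
    refine norm_sub_le_of_locally (G := fun r => riemGrad n (fun z => F (γ r, z)) y)
      (fun t₀ ht₀ => ?_) hs ht hst
    obtain ⟨δ, hδ, hsub, ν, -, -, htr⟩ := hγ.exists_local_transport (d := m) ht₀
    refine ⟨δ, hδ, fun a ha b hb hab => ?_⟩
    obtain ⟨w, hw, -⟩ := htr a ha b hb hab
      (riemGrad m (fun z => F (z, y)) (γ (a + 0 * (b - a))))
    -- Since y is fixed, the N-component is transported trivially and both gradients lie in one
    -- tangent space. The vector w only completes the product condition, and its component is
    -- dropped.
    have h1 := hl (fun τ => γ (a + τ * (b - a))) (fun _ => y)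
      (hγ.restrict (hsub ha).1.le hab.le (hsub hb).2.le) (isMinGeodesic_const y) w _ hw
      (isParallelTransport_const y _)
    have e0 : a + 0 * (b - a) = a := by ring
    have e1 : a + 1 * (b - a) = b := by ring
    have hdist : dist (γ (a + 0 * (b - a))) (γ (a + 1 * (b - a))) = (b - a) * D := by
      rw [e0, e1, hγ a (Ioo_subset_Icc_self (hsub ha)) b (Ioo_subset_Icc_self (hsub hb)),
        abs_sub_comm, abs_of_pos (by linarith)]
    have hba : 0 ≤ (b - a) * D := mul_nonneg (by linarith) dist_nonneg
    rw [dist_self, hdist, zero_pow two_ne_zero, add_zero, Real.sqrt_sq hba] at h1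
    have h2 : ‖riemGrad n (fun z => F (γ (a + 0 * (b - a)), z)) y
        - riemGrad n (fun z => F (γ (a + 1 * (b - a)), z)) y‖ ≤ l * ((b - a) * D) := by
      refine le_trans ?_ h1
      exact Real.le_sqrt_of_sq_le (le_add_of_nonneg_left (sq_nonneg _))
    rw [e0, e1, norm_sub_rev] at h2
    exact h2.trans_eq (by ring)
  -- The gradient bound is available only in the interior of γ; the endpoints are reached by
  -- continuity as r tends to 0.
  have hint : ∀ r ∈ Ioo (0 : ℝ) (1 / 2),
      |(F (γ (1 - r), σ 1) - F (γ r, σ 1)) - (F (γ (1 - r), σ 0) - F (γ r, σ 0))|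
        ≤ l * D * (1 - r - r) * dist (σ 0) (σ 1) := by
    intro r hr
    exact hσ.abs_sub_le_of_grad (d := n) (mdifferentiable_slice hF _) (mdifferentiable_slice hF _)
      fun y => hgrad y r ⟨hr.1, by linarith [hr.2]⟩ (1 - r)
        ⟨by linarith [hr.2], by linarith [hr.1]⟩ (by linarith [hr.2])
  have hγ0 : Tendsto γ (𝓝[Icc 0 1] 0) (𝓝 (γ 0)) := hγ.continuousOn 0 (by simp)
  have hγ1 : Tendsto γ (𝓝[Icc 0 1] 1) (𝓝 (γ 1)) := hγ.continuousOn 1 (by simp)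
  have hr0 : Tendsto (fun r : ℝ => r) (𝓝[>] 0) (𝓝[Icc 0 1] 0) := by
    refine tendsto_nhdsWithin_iff.2 ⟨tendsto_id.mono_left nhdsWithin_le_nhds, ?_⟩
    filter_upwards [Ioo_mem_nhdsGT (zero_lt_one' ℝ)] with r hr using Ioo_subset_Icc_self hr
  have hr1 : Tendsto (fun r : ℝ => 1 - r) (𝓝[>] 0) (𝓝[Icc 0 1] 1) := by
    refine tendsto_nhdsWithin_iff.2 ⟨?_, ?_⟩
    · have : Tendsto (fun r : ℝ => 1 - r) (𝓝 0) (𝓝 (1 - 0)) := Continuous.tendsto (by fun_prop) 0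
      rw [sub_zero] at this
      exact this.mono_left nhdsWithin_le_nhds
    · filter_upwards [Ioo_mem_nhdsGT (zero_lt_one' ℝ)] with r hr
      exact ⟨by linarith [hr.2], by linarith [hr.1]⟩
  have hlim : ∀ (y : N) {α : ℝ → M} {x : M}, Tendsto α (𝓝[>] (0 : ℝ)) (𝓝 x) →
      Tendsto (fun r => F (α r, y)) (𝓝[>] (0 : ℝ)) (𝓝 (F (x, y))) := fun y α x h =>
    (hF.continuous.tendsto (x, y)).comp (h.prodMk_nhds tendsto_const_nhds)
  have hL := ((hlim (σ 1) (hγ1.comp hr1)).sub (hlim (σ 1) (hγ0.comp hr0))).sub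
    ((hlim (σ 0) (hγ1.comp hr1)).sub (hlim (σ 0) (hγ0.comp hr0)))
  have hR : Tendsto (fun r : ℝ => l * D * (1 - r - r) * dist (σ 0) (σ 1)) (𝓝[>] 0)
      (𝓝 (l * D * (1 - 0 - 0) * dist (σ 0) (σ 1))) :=
    (Continuous.tendsto (by fun_prop) 0).mono_left nhdsWithin_le_nhds
  rw [sub_zero, sub_zero, mul_one] at hR
  refine le_of_tendsto_of_tendsto hL.abs hR ?_
  filter_upwards [Ioo_mem_nhdsGT (show (0 : ℝ) < 1 / 2 by norm_num)] with r hr using hint r hr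

end Product

/-! ### Hopf-Rinow for manifolds, and the penalized objective. -/

theorem properSpace_of_complete (d : ℕ) (M : Type*) [MetricSpace M] [CompleteSpace M]
    [ChartedSpace (EuclideanSpace ℝ (Fin d)) M]
    [RiemannianBundle (fun x : M => TangentSpace (𝓡 d) x)] [IsRiemannianManifold (𝓡 d) M] :
    ProperSpace M :=
  have : LocallyCompactSpace M := ChartedSpace.locallyCompactSpace (EuclideanSpace ℝ (Fin d)) M
  ⟨(hasApproxBetween_of_isRiemannianManifold d M).isCompact_closedBall⟩

/-- The Hopf-Rinow theorem: points of a complete Riemannian manifold are joined by minimizing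
geodesics. -/
theorem exists_isMinGeodesic_of_complete (d : ℕ) (M : Type*) [MetricSpace M] [CompleteSpace M]
    [ChartedSpace (EuclideanSpace ℝ (Fin d)) M]
    [RiemannianBundle (fun x : M => TangentSpace (𝓡 d) x)] [IsRiemannianManifold (𝓡 d) M] (x y : M) :
    ∃ γ : ℝ → M, IsMinGeodesic γ ∧ γ 0 = x ∧ γ 1 = y :=
  have := properSpace_of_complete d M
  (hasApproxBetween_of_isRiemannianManifold d M).exists_isMinGeodesic x y

/-- The term with g* does not depend on y, so it drops out whatever its value. -/
theorem isMinOn_lagrangian_iff {M N : Type*} {f g : M × N → ℝ} {lam : ℝ} {x : M} {y : N} :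
    IsMinOn (lagrangian f g lam x) univ y ↔
      IsMinOn (fun z => f (x, z) + lam * g (x, z)) univ y := by
  simp only [isMinOn_iff, mem_univ, forall_true_left, lagrangian]
  refine forall_congr' fun z => ?_
  constructor <;> intro h <;> linarith

section Product

variable {m n : ℕ}
  {M : Type*} [MetricSpace M] [ChartedSpace (EuclideanSpace ℝ (Fin m)) M]
  [IsManifold (𝓡 m) ∞ M] [RiemannianBundle (fun x : M => TangentSpace (𝓡 m) x)]
  [IsContMDiffRiemannianBundle (𝓡 m) ∞ (EuclideanSpace ℝ (Fin m))
      (fun x : M => TangentSpace (𝓡 m) x)]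
  {N : Type*} [MetricSpace N] [ChartedSpace (EuclideanSpace ℝ (Fin n)) N]
  [IsManifold (𝓡 n) ∞ N] [RiemannianBundle (fun y : N => TangentSpace (𝓡 n) y)]
  [IsContMDiffRiemannianBundle (𝓡 n) ∞ (EuclideanSpace ℝ (Fin n))
      (fun y : N => TangentSpace (𝓡 n) y)]
  [IsRiemannianManifold (𝓡 n) N] {f g : M × N → ℝ} {lf1 lg1 μg : ℝ}

/-- A penalized objective with penalty parameter `lam` is strongly convex with modulus
`lam * μg - lf1`. -/
theorem geodStronglyConvex_penalized
    (hf : ContMDiff ((𝓡 m).prod (𝓡 n)) 𝓘(ℝ, ℝ) 1 f) (hf_lip : LipschitzGradient m n lf1 f)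
    (hg_conv : ∀ x : M, GeodStronglyConvex μg (fun y : N => g (x, y))) {lam : ℝ} (hlam : 0 ≤ lam)
    (x : M) : GeodStronglyConvex (lam * μg - lf1) (fun z => f (x, z) + lam * g (x, z)) := by
  intro γ hγ t ht
  have h1 := (abs_le.1 (hf_lip.abs_sub_interpolation_le hf x hγ ht)).2
  have h2 := mul_le_mul_of_nonneg_left (hg_conv x γ hγ t ht) hlam
  simp only at h2 ⊢
  linarith

/-- A strong convexity modulus is at most the Lipschitz constant of the gradient. -/
theorem LipschitzGradient.modulus_le (hg : ContMDiff ((𝓡 m).prod (𝓡 n)) 𝓘(ℝ, ℝ) 1 g)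
    (hg_lip : LipschitzGradient m n lg1 g) {x : M}
    (hg_conv : GeodStronglyConvex μg (fun y : N => g (x, y))) {γ : ℝ → N} (hγ : IsMinGeodesic γ)
    (hne : γ 0 ≠ γ 1) : μg ≤ lg1 := by
  have ht : (1 / 2 : ℝ) ∈ Icc (0 : ℝ) 1 := by constructor <;> norm_num
  -- At the midpoint, g is below its interpolation by at least μg/8 and by at most lg1/8 times the
  -- squared distance.
  have h1 := (abs_le.1 (hg_lip.abs_sub_interpolation_le hg x hγ ht)).1
  have h2 := hg_conv γ hγ _ ht
  simp only at h2
  have hD : 0 < dist (γ 0) (γ 1) ^ 2 := pow_pos (dist_pos.2 hne) 2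
  have h3 : μg * dist (γ 0) (γ 1) ^ 2 ≤ lg1 * dist (γ 0) (γ 1) ^ 2 := by linarith
  exact le_of_mul_le_mul_right h3 hD

end Product

/-- Cancelling one factor of a distance. -/
theorem mul_le_of_mul_sq_le {κ C D : ℝ} (hD : 0 ≤ D) (hC : 0 ≤ C) (h : κ * D ^ 2 ≤ C * D) :
    κ * D ≤ C := by
  rcases hD.eq_or_lt with rfl | hD
  · simpa using hC
  · exact le_of_mul_le_mul_right (by linarith) hD

end RiemBilevel

end

/-! ### Existence of the minimizers and the distance bounds. -/

open RiemBilevel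

theorem lemma2 {m n : ℕ}
    {M : Type*} [MetricSpace M] [CompleteSpace M] [Nonempty M]
    [ChartedSpace (EuclideanSpace ℝ (Fin m)) M] [IsManifold (𝓡 m) ∞ M]
    [RiemannianBundle (fun x : M => TangentSpace (𝓡 m) x)]
    [IsContMDiffRiemannianBundle (𝓡 m) ∞ (EuclideanSpace ℝ (Fin m))
      (fun x : M => TangentSpace (𝓡 m) x)]
    [IsRiemannianManifold (𝓡 m) M]
    {N : Type*} [MetricSpace N] [CompleteSpace N] [Nonempty N]
    [ChartedSpace (EuclideanSpace ℝ (Fin n)) N] [IsManifold (𝓡 n) ∞ N]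
    [RiemannianBundle (fun y : N => TangentSpace (𝓡 n) y)]
    [IsContMDiffRiemannianBundle (𝓡 n) ∞ (EuclideanSpace ℝ (Fin n))
      (fun y : N => TangentSpace (𝓡 n) y)]
    [IsRiemannianManifold (𝓡 n) N]
    (f g : M × N → ℝ) (lf0 lf1 lg1 μg : ℝ)
    (hlf1 : 0 ≤ lf1) (hlg1 : 0 ≤ lg1) (hμg : 0 < μg)
    (hf : ContMDiff ((𝓡 m).prod (𝓡 n)) 𝓘(ℝ, ℝ) 1 f)
    (hg : ContMDiff ((𝓡 m).prod (𝓡 n)) 𝓘(ℝ, ℝ) 1 g)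
    (hf_lip : RiemBilevel.LipschitzGradient m n lf1 f)
    (hg_lip : RiemBilevel.LipschitzGradient m n lg1 g)
    (hf_bdd : ∀ (x : M) (y : N), ‖RiemBilevel.riemGrad n (fun z : N => f (x, z)) y‖ ≤ lf0)
    (hg_conv : ∀ x : M, RiemBilevel.GeodStronglyConvex μg (fun y : N => g (x, y))) :
    -- the minimizers `y*(x)` and `y*_λ(x)` exist and are unique
    (∀ x : M, ∃! y : N, IsMinOn (fun z => g (x, z)) univ y) ∧
    (∀ lam : ℝ, 0 < lam → 2 * lf1 / μg ≤ lam → ∀ x : M,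
      ∃! y : N, IsMinOn (RiemBilevel.lagrangian f g lam x) univ y) ∧
    -- the bound on the distance between `y*_{λ₁}(x₁)` and `y*_{λ₂}(x₂)`
    (∃ l : ℝ, l ≤ 3 * lg1 / μg ∧
      ∀ lam₁ lam₂ : ℝ, 0 < lam₁ → 2 * lf1 / μg ≤ lam₁ → lam₁ ≤ lam₂ →
      ∀ (x₁ x₂ : M) (y₁ y₂ : N),
        IsMinOn (RiemBilevel.lagrangian f g lam₁ x₁) univ y₁ →
        IsMinOn (RiemBilevel.lagrangian f g lam₂ x₂) univ y₂ →
        dist y₁ y₂ ≤ 2 * (lam₂ - lam₁) / (lam₁ * lam₂) * (lf0 / μg) + l * dist x₂ x₁) ∧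
    -- the bound on the distance between `y*_λ(x)` and `y*(x)`
    (∀ lam : ℝ, 0 < lam → 2 * lf1 / μg ≤ lam → ∀ (x : M) (y y₀ : N),
      IsMinOn (RiemBilevel.lagrangian f g lam x) univ y →
      IsMinOn (fun z => g (x, z)) univ y₀ →
      dist y y₀ ≤ 2 * lf0 / (lam * μg)) := by
  have hN := exists_isMinGeodesic_of_complete n N
  have hM := exists_isMinGeodesic_of_complete m M
  have hprop := properSpace_of_complete n N
  have hlf0 : 0 ≤ lf0 :=
    (norm_nonneg _).trans (hf_bdd (Classical.arbitrary M) (Classical.arbitrary N))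
  have hfc : ∀ x, Continuous fun z => f (x, z) := fun x => (mdifferentiable_slice hf x).continuous
  have hgc : ∀ x, Continuous fun z => g (x, z) := fun x => (mdifferentiable_slice hg x).continuous
  have hfLip : ∀ (x : M) (y z : N), f (x, z) - f (x, y) ≤ lf0 * dist y z := by
    intro x y z
    obtain ⟨γ, hγ, h0, h1⟩ := hN y z
    have hzero : ∀ w : N, riemGrad n (fun _ : N => (0 : ℝ)) w = 0 := fun w => by
      refine (inner_self_eq_zero (𝕜 := ℝ)).1 ?_
      rw [inner_riemGrad, mfderiv_const]; rfl
    have h := hγ.abs_sub_le_of_grad (d := n) (mdifferentiable_slice hf x)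
      (φ₂ := fun _ => (0 : ℝ)) mdifferentiable_const (k := lf0) fun w => by
        rw [hzero, sub_zero]; exact hf_bdd x w
    rw [h0, h1] at h
    linarith [(abs_le.1 h).2]
  -- The threshold on λ keeps at least half of λμ_g as the modulus of the penalized objective.
  have hmod : ∀ lam : ℝ, 2 * lf1 / μg ≤ lam → lf1 ≤ lam * μg / 2 := by
    intro lam h
    rw [div_le_iff₀ hμg] at h
    linarith
  have hconv : ∀ lam : ℝ, 0 < lam → 2 * lf1 / μg ≤ lam → ∀ x : M,
      GeodStronglyConvex (lam * μg - lf1) (fun z => f (x, z) + lam * g (x, z)) :=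
    fun lam hlam _ x => geodStronglyConvex_penalized hf hf_lip hg_conv hlam.le x
  have hex : ∀ lam : ℝ, 0 < lam → 2 * lf1 / μg ≤ lam → ∀ x : M,
      ∃! y : N, IsMinOn (fun z => f (x, z) + lam * g (x, z)) univ y := by
    intro lam hlam hl x
    refine (hconv lam hlam hl x).existsUnique_isMinOn hN ?_
      ((hfc x).add (continuous_const.mul (hgc x)))
    linarith [hmod lam hl, mul_pos hlam hμg]
  refine ⟨fun x => (hg_conv x).existsUnique_isMinOn hN hμg (hgc x), ?_, ?_, ?_⟩
  · intro lam hlam hl x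
    simpa only [isMinOn_lagrangian_iff] using hex lam hlam hl x
  -- If N is a point, μg ≤ lg1 may fail, but all minimizers coincide and the constant 0 works.
  · rcases subsingleton_or_nontrivial N with hsub | hnt
    · refine ⟨0, by positivity, fun lam₁ lam₂ h0 _ h12 x₁ x₂ y₁ y₂ _ _ => ?_⟩
      rw [Subsingleton.elim y₁ y₂, dist_self, zero_mul, add_zero]
      have : 0 ≤ lam₂ - lam₁ := by linarith
      have : 0 < lam₂ := by linarith
      positivity
    have hμl : μg ≤ lg1 := by
      obtain ⟨y, z, hyz⟩ := exists_pair_ne N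
      obtain ⟨γ, hγ, h0, h1⟩ := hN y z
      exact hg_lip.modulus_le hg (hg_conv (Classical.arbitrary M)) hγ (by rwa [h0, h1])
    refine ⟨3 * lg1 / μg, le_rfl, fun lam₁ lam₂ hl0 hl1 h12 x₁ x₂ y₁ y₂ hy₁ hy₂ => ?_⟩
    rw [isMinOn_lagrangian_iff] at hy₁ hy₂
    have hl2 : 0 < lam₂ := by linarith
    have hm1 := hmod lam₁ hl1
    have hm2 := hmod lam₂ (hl1.trans h12)
    -- The intermediate point a = y*_{λ₁}(x₂) separates the change of x from the change of λ.
    obtain ⟨a, ha, -⟩ := hex lam₁ hl0 hl1 x₂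
    have hκ : 0 < lam₁ * μg / 2 := by positivity
    have first : dist y₁ a ≤ 3 * lg1 / μg * dist x₂ x₁ := by
      have g1 := (hconv lam₁ hl0 hl1 x₁).growth hN hy₁ a
      have g2 := (hconv lam₁ hl0 hl1 x₂).growth hN ha y₁
      rw [dist_comm a y₁] at g2
      obtain ⟨γ, hγ, γ0, γ1⟩ := hM x₂ x₁
      obtain ⟨σ, hσ, σ0, σ1⟩ := hN y₁ a
      have m1 := (abs_le.1 (hf_lip.abs_mixed_difference_le hf hγ hσ)).2
      have m2 := (abs_le.1 (hg_lip.abs_mixed_difference_le hg hγ hσ)).2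
      rw [γ0, γ1, σ0, σ1] at m1 m2
      have m3 := mul_le_mul_of_nonneg_left m2 hl0.le
      have hd := dist_nonneg (x := x₂) (y := x₁)
      -- The growth inequalities at x₁ and x₂ add up to a mixed difference of f + λ₁g, controlled by
      -- m1 and m3.
      have s1 : (lam₁ * μg - lf1) * dist y₁ a ^ 2
          ≤ ((lf1 + lam₁ * lg1) * dist x₂ x₁) * dist y₁ a := by
        linarith
      have s2 := mul_le_of_mul_sq_le dist_nonneg (by positivity) s1
      have s3 : lam₁ * μg / 2 * dist y₁ a ≤ (lam₁ * μg - lf1) * dist y₁ a := by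
        gcongr; linarith
      -- From lf1 ≤ λ₁μg/2 ≤ λ₁lg1/2; then 3λ₁lg1/2 divided by λ₁μg/2 is the constant 3lg1/μg.
      have s4 : (lf1 + lam₁ * lg1) * dist x₂ x₁ ≤ (lam₁ * lg1 / 2 + lam₁ * lg1) * dist x₂ x₁ := by
        gcongr
        refine hm1.trans ?_
        gcongr
      have s5 : lam₁ * μg / 2 * dist y₁ a
          ≤ lam₁ * μg / 2 * (3 * lg1 / μg * dist x₂ x₁) := by
        refine s3.trans (s2.trans (s4.trans (le_of_eq ?_)))
        field_simp
        ring
      exact le_of_mul_le_mul_left s5 hκ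
    have second : dist a y₂ ≤ 2 * (lam₂ - lam₁) / (lam₁ * lam₂) * (lf0 / μg) := by
      -- With weights λ₂ on the inequality for λ₁ and λ₁ on that for λ₂, both carry λ₁λ₂g and the g
      -- terms cancel.
      have g1 := mul_le_mul_of_nonneg_left ((hconv lam₁ hl0 hl1 x₂).growth hN ha y₂) hl2.le
      have g2 := mul_le_mul_of_nonneg_left
        ((hconv lam₂ hl2 (hl1.trans h12) x₂).growth hN hy₂ a) hl0.le
      rw [dist_comm y₂ a] at g2
      have hL := mul_le_mul_of_nonneg_left (hfLip x₂ a y₂) (show 0 ≤ lam₂ - lam₁ by linarith)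
      have c1 : lam₂ * (lam₁ * μg / 2) * dist a y₂ ^ 2
          ≤ lam₂ * (lam₁ * μg - lf1) * dist a y₂ ^ 2 := by
        gcongr; linarith
      have c2 : lam₁ * (lam₂ * μg / 2) * dist a y₂ ^ 2
          ≤ lam₁ * (lam₂ * μg - lf1) * dist a y₂ ^ 2 := by
        gcongr; linarith
      have s1 : (lam₁ * lam₂ * μg / 2) * dist a y₂ ^ 2
          ≤ ((lam₂ - lam₁) * lf0) * dist a y₂ := by
        linarith
      have s2 := mul_le_of_mul_sq_le dist_nonneg
        (mul_nonneg (by linarith) hlf0) s1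
      have hpos : 0 < lam₁ * lam₂ * μg / 2 := by positivity
      refine le_of_mul_le_mul_left (s2.trans (le_of_eq ?_)) hpos
      field_simp
    linarith [dist_triangle y₁ a y₂]
  · intro lam hlam hl x y y₀ hy hy₀
    rw [isMinOn_lagrangian_iff] at hy
    -- Growth of g alone suffices: λμg/2·d² ≤ λ(g(y) - g(y₀)) ≤ f(y₀) - f(y) ≤ lf0·d.
    have g1 := mul_le_mul_of_nonneg_left ((hg_conv x).growth hN hy₀ y) hlam.le
    have g2 : f (x, y) + lam * g (x, y) ≤ f (x, y₀) + lam * g (x, y₀) := hy (mem_univ y₀)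
    have hL := hfLip x y y₀
    rw [dist_comm y₀ y] at g1
    have s1 : (lam * μg / 2) * dist y y₀ ^ 2 ≤ lf0 * dist y y₀ := by
      linarith
    have s2 := mul_le_of_mul_sq_le dist_nonneg hlf0 s1
    rw [le_div_iff₀ (by positivity)]
    linarith
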